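/- **Setting.** Fix $d\in\mathbb N$ and write $\mathbb N=\{1,2,\dots\}$, $\mathbb N_0=\mathbb N\cup\{0\}$. For every $k\in\mathbb N$ let $G_k\subset\mathbb Z^d$ be a set with $|G_k|=k$ and $[-L_k,L_k]^d\cap\mathbb Z^d\subset G_k\subset[-L_k-1,L_k+1]^d\cap\mathbb Z^d$ for some $L_k\in\mathbb N_0$. Let $v\colon\mathbb Z^d\to[0,\infty)$ be symmetric ($v(-x)=v(x)$) with finite support, $\bar v=\sum_{z}v(z)$, and let $q=(q_k)_{k\in\mathbb N}$ be a summable sequence of positive numbers. A configuration is a family $\omega=(\xi^{(k)}(x))_{x\in\mathbb Z^d,k\in\mathbb N}$ of numbers in $\mathbb N_0$; $\Omega$ is the set of all configurations, with the product $\sigma$-algebra, and $\mathcal M_1^{\rm s}(\Omega)$ is the set of shift-invariant probability measures on $\Omega$. Put $N_0^{(\delta_k)}(\omega)=\xi^{(k)}(0)$, $N_0^{(\ell)}(\omega)=\sum_k k\,\xi^{(k)}(0)$ and $$\Phi_{0,\mathbb Z^d}(\omega)=\sum_{y\in\mathbb Z^d}\sum_{k,l\in\mathbb N}\xi^{(k)}(0)\,\xi^{(l)}(y)\,T_{0,y}(G_k,G_l),\qquad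 T_{x,y}(G,G')=\sum_{i\in G}\sum_{j\in G'}v(x+i-y-j).$$ Write $P(f)=\int f\,dP\in[0,\infty]$. For $m\in[0,\infty)^{\mathbb N}$ let $\mathbb P^m$ be the law under which all $\xi^{(k)}(x)$ are independent and $\xi^{(k)}(x)$ is Poisson with parameter $m_k$. Let $$I_m(P)=\lim_{n\to\infty}\frac1{|Q_n|}H(P_{Q_n}|\mathbb P^m_{Q_n}),\qquad Q_n=[-n,n]^d\cap\mathbb Z^d,$$ where $P_Q$ is the projection of $P$ to the configurations in $Q$ and $H(\cdot|\cdot)\in[0,\infty]$ is the relative entropy, and put $I=I_q$. Also let $H(m|q)=\sum_k\big(q_k-m_k+m_k\log\frac{m_k}{q_k}\big)\in[0,\infty]$ with $0\log0=0$. Let $\mathcal M_1(\mathbb N_0)$ be the set of probability measures on $\mathbb N_0$, with $\psi\leq_{\rm st}\psi'$ iff $\psi([a,\infty))\le\psi'([a,\infty))$ for all $a\in\mathbb N_0$. For $m\in[0,\infty)^{\mathbb N}$ and $\psi\in\mathcal M_1(\mathbb N_0)$ define $$\varphi(m,\psi)=\inf\sum_{a\in\mathbb N_0}\psi(a)\Big[I(P_a)+P_a(\Phi_{0,\mathbb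 Z^d})+2\bar v\,a\,P_a(N_0^{(\ell)})+\bar v\,a^2\Big]\in[0,\infty],$$ the infimum being over all $P_0,P_1,\dots\in\mathcal M_1^{\rm s}(\Omega)$ with $\sum_a\psi(a)P_a(N_0^{(\delta_k)})=m_k$ for all $k\in\mathbb N$ (with $0\cdot\infty=0$ and $\inf\emptyset=\infty$). For $\rho_{\rm mi},\rho_{\rm ma}\in[0,\infty)$ let $$\chi(\rho_{\rm mi},\rho_{\rm ma})=\inf\Big\{\varphi(m,\psi)\colon m\in[0,\infty)^{\mathbb N},\ \psi\in\mathcal M_1(\mathbb N_0),\ \sum_k k m_k=\rho_{\rm mi},\ \sum_a a\psi(a)=\rho_{\rm ma}\Big\},$$ and let $\chi^{(v=0)}$ be the function $\chi$ of the model with $v$ replaced by $0$. **Lemma.** The limit defining $I_m(P)$ exists in $[0,\infty]$ for all $m\in[0,\infty)^{\mathbb N}$ and $P\in\mathcal M_1^{\rm s}(\Omega)$. Moreover: 1. $\varphi$ is jointly convex in $(m,\psi)$. 2. $\chi$ is finite, jointly convex and jointly continuous on $[0,\infty)^2$. In particular $\rho\mapsto\chi(\rho,0)$ is convex. 3. For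 every $m$, if $\psi\leq_{\rm st}\psi'$, then $\varphi(m,\psi)\le\varphi(m,\psi')$. 4. $\chi$ is non-decreasing in $\rho_{\rm ma}$. 5. For every $m\in[0,\infty)^{\mathbb N}$ and every $P\in\mathcal M_1^{\rm s}(\Omega)$ with $P(N_0^{(\delta_k)})=m_k$ for all $k\in\mathbb N$, we have $I(P)=H(m|q)+I_m(P)$. In particular $I(\mathbb P^m)=H(m|q)$ for every $m\in[0,\infty)^{\mathbb N}$. 6. $\chi(0,0)=\chi^{(v=0)}(0,0)=\sum_k q_k$, and $\lim_{\rho\downarrow0}\frac{\chi(\rho,0)-\chi(0,0)}{\rho}=-\infty$. 7. For every $\rho\in[0,\infty)$, $\chi(\rho,0)\le\chi^{(v=0)}(\rho,0)+\bar v(\rho^2+\rho)$; and if $2v(0)\ge\bar v$, then $\chi^{(v=0)}(\rho,0)+\bar v\rho^2\le\chi(\rho,0)$ for every $\rho\in[0,\infty)$. -/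

import Mathlib

open MeasureTheory Filter Topology
open scoped NNReal ENNReal

namespace BoxBoseGas

noncomputable section

/-- Sites of the lattice `ℤ^d`. -/
abbrev Site (d : ℕ) : Type := Fin d → ℤ

/-- The space `Ω` of configurations: `ω (x, k)` is the number `ξ⁽ᵏ⁾(x)` of points at the site `x`
carrying the mark of size `k ≥ 1`. As a function type it carries the product σ-algebra,
i.e. the one generated by all evaluations. -/
abbrev Config (d : ℕ) : Type := Site d × ℕ+ → ℕ

/-- The centred box `[-n, n]^d ∩ ℤ^d`. -/
def box (d n : ℕ) : Finset (Site d) := Finset.Icc (fun _ => -(n : ℤ)) (fun _ => (n : ℤ))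

/-- Admissible families of marks: `G k` has exactly `k` elements and lies between two consecutive
centred boxes. -/
def IsMarkFamily {d : ℕ} (G : ℕ+ → Finset (Site d)) : Prop :=
  ∀ k : ℕ+, (G k).card = k ∧ ∃ L : ℕ, box d L ⊆ G k ∧ G k ⊆ box d (L + 1)

/-- `v̄ = ∑_z v(z)`. -/
def vbar {d : ℕ} (v : Site d → ℝ≥0) : ℝ≥0 := ∑' z, v z

/-- `T_{x,y}(G, G') = ∑_{i ∈ G} ∑_{j ∈ G'} v(x + i - y - j)`. -/
def pairEnergy {d : ℕ} (v : Site d → ℝ≥0) (x y : Site d) (G G' : Finset (Site d)) : ℝ≥0 :=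
  ∑ i ∈ G, ∑ j ∈ G', v (x + i - y - j)

/-- `Φ_{0,ℤ^d}(ω) = ∑_y ∑_{k,l} ξ⁽ᵏ⁾(0) ξ⁽ˡ⁾(y) T_{0,y}(G_k, G_l)`. -/
def energyAtOrigin {d : ℕ} (G : ℕ+ → Finset (Site d)) (v : Site d → ℝ≥0) (ω : Config d) : ℝ≥0∞ :=
  ∑' (y : Site d) (k : ℕ+) (l : ℕ+),
    (ω (0, k) : ℝ≥0∞) * (ω (y, l) : ℝ≥0∞) * (pairEnergy v 0 y (G k) (G l) : ℝ≥0∞)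

/-- The number of particles belonging to points at the origin,
`N_0^{(ℓ)}(ω) = ∑_k k ξ⁽ᵏ⁾(0)`. -/
def particlesAtOrigin {d : ℕ} (ω : Config d) : ℝ≥0∞ :=
  ∑' k : ℕ+, ((k : ℕ) : ℝ≥0∞) * (ω (0, k) : ℝ≥0∞)

/-- The spatial shift by `z`. -/
def shift {d : ℕ} (z : Site d) (ω : Config d) : Config d := fun p => ω (p.1 + z, p.2)

/-- The shift-invariant probability measures on `Ω`. -/
def stationary (d : ℕ) : Set (Measure (Config d)) :=
  {P | IsProbabilityMeasure P ∧ ∀ z : Site d, P.map (shift z) = P}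

/-- The marked Poisson point process with intensities `m`: the `ξ⁽ᵏ⁾(x)` are independent and
`ξ⁽ᵏ⁾(x)` is Poisson with parameter `m k`. -/
def poissonProcess (d : ℕ) (m : ℕ+ → ℝ≥0) : Measure (Config d) :=
  Measure.infinitePi fun p : Site d × ℕ+ => ProbabilityTheory.poissonMeasure (m p.2)

/-- The projection of a law on `Ω` to the configurations on `Λ`. -/
def proj {d : ℕ} (Λ : Finset (Site d)) (P : Measure (Config d)) :
    Measure ({p : Site d × ℕ+ // p.1 ∈ Λ} → ℕ) :=
  P.map fun ω p => ω p.1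

/-- The relative entropy per site in the centred box of radius `n`, with respect to the Poisson
process with intensities `m`. -/
def boxEntropy {d : ℕ} (m : ℕ+ → ℝ≥0) (P : Measure (Config d)) (n : ℕ) : ℝ≥0∞ :=
  InformationTheory.klDiv (proj (box d n) P) (proj (box d n) (poissonProcess d m)) /
    ((box d n).card : ℝ≥0∞)

/-- The entropy density `I_m(P)`, the limit of `boxEntropy m P n` as `n → ∞`. It is written as a
lower limit in order to be defined for every `P`. -/
def entropyDensity {d : ℕ} (m : ℕ+ → ℝ≥0) (P : Measure (Config d)) : ℝ≥0∞ :=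
  liminf (boxEntropy m P) atTop

/-- `H(m|q) = ∑_k (q_k - m_k + m_k log (m_k / q_k))`, where `0 log 0 = 0`. For `q_k > 0` each
summand is nonnegative, so that `ENNReal.ofReal` does not truncate. -/
def relEntropy (m q : ℕ+ → ℝ≥0) : ℝ≥0∞ :=
  ∑' k, ENNReal.ofReal ((q k : ℝ) - m k + m k * Real.log (m k / q k))

/-- The probability measures on `ℕ₀`, as weight functions. -/
def probs : Set (ℕ → ℝ≥0) := {ψ | HasSum ψ 1}

/-- The stochastic order: `ψ([a,∞)) ≤ ψ'([a,∞))` for all `a`. -/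
def StochLE (ψ ψ' : ℕ → ℝ≥0) : Prop :=
  ∀ a : ℕ, ∑' b : Set.Ici a, ψ b ≤ ∑' b : Set.Ici a, ψ' b

/-- The families `(P_a)` admissible for `φ(m, ψ)`: each `P_a` is a shift-invariant probability
measure, and `∑_a ψ(a) P_a(N_0^{(δ_k)}) = m_k` for all `k`. -/
def admissible (d : ℕ) (m : ℕ+ → ℝ≥0) (ψ : ℕ → ℝ≥0) : Set (ℕ → Measure (Config d)) :=
  {P | (∀ a, P a ∈ stationary d) ∧
    ∀ k : ℕ+, ∑' a, (ψ a : ℝ≥0∞) * ∫⁻ ω, (ω (0, k) : ℝ≥0∞) ∂(P a) = m k}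

/-- The functional `φ(m, ψ)` of the model with marks `G`, interaction `v` and intensities `q`. -/
def phi {d : ℕ} (G : ℕ+ → Finset (Site d)) (v : Site d → ℝ≥0) (q : ℕ+ → ℝ≥0)
    (m : ℕ+ → ℝ≥0) (ψ : ℕ → ℝ≥0) : ℝ≥0∞ :=
  ⨅ P ∈ admissible d m ψ,
    ∑' a : ℕ, (ψ a : ℝ≥0∞) *
      (entropyDensity q (P a) + ∫⁻ ω, energyAtOrigin G v ω ∂(P a)
        + 2 * (vbar v : ℝ≥0∞) * (a : ℝ≥0∞) * ∫⁻ ω, particlesAtOrigin ω ∂(P a)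
        + (vbar v : ℝ≥0∞) * (a : ℝ≥0∞) ^ 2)

/-- The function `χ(ρ_mi, ρ_ma)`: the infimum of `φ(m, ψ)` over all `m ∈ [0,∞)^ℕ` with
`∑_k k m_k = ρ_mi` and all probability measures `ψ` on `ℕ₀` with `∑_a a ψ(a) = ρ_ma`. -/
def chi {d : ℕ} (G : ℕ+ → Finset (Site d)) (v : Site d → ℝ≥0) (q : ℕ+ → ℝ≥0)
    (ρmi ρma : ℝ≥0) : ℝ≥0∞ :=
  ⨅ (m : ℕ+ → ℝ≥0) (_ : HasSum (fun k : ℕ+ => ((k : ℕ) : ℝ≥0) * m k) ρmi)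
    (ψ : ℕ → ℝ≥0) (_ : ψ ∈ probs) (_ : HasSum (fun a : ℕ => (a : ℝ≥0) * ψ a) ρma),
    phi G v q m ψ

end

end BoxBoseGas

/-! Everything rests on a few facts about relative entropy. By the Donsker–Varadhan formula, `klDiv
μ ν` is a supremum of the functionals `∫ f dμ - log ∫ exp f dν` over bounded measurable `f`. These
are affine in `μ`, so relative entropy is convex under countable mixtures, and it is determined by
images generating the σ-algebra. The chain rule makes it superadditive against product measures. For
a stationary law, tiling a large box with translates of a small one then shows that no box entropy
per site exceeds the liminf. Hence the entropy density is both the limit and the supremum of the box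
entropies (`entropyDensity_eq_iSup`).

Changing Poisson intensities from `q` to `m` adds a log-density that is affine in the occupation
numbers. Its mean depends only on the intensities of `P`, which gives `I(P) = H(m|q) + I_m(P)` on
finite blocks and then in the limit (`entropyDensity_eq_add`).

All terms of the cost are affine in the law except the convex entropy, so laws may be mixed and
moved between levels `a` (`phi_le_of_weights`). Mixing two families gives convexity of `φ`. Moving
laws down along a monotone coupling gives monotonicity in the stochastic order. Both pass to `χ`.

For `ρ_ma = 0` only `a = 0` matters. The Poisson process of intensity `m` bounds `φ` from above by
`H(m|q)` plus an explicit energy, while dropping the energy bounds it below by `H(m|q)`. The entropy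
of putting a few particles into marks of size one produces the slope `log ρ → -∞`. If `v̄ ≤ 2 v(0)`,
a second-moment inequality for the particle numbers bounds the energy below by `v̄ρ²`.

Convexity yields continuity of `χ` in the open quadrant and upper bounds by chords at the axes. The
missing lower bounds are monotonicity at `ρ_ma = 0` and, at `ρ_mi = 0`, the estimate
`chi_zero_left_le`, which removes all microscopic particles. -/

namespace BoxBoseGas

open InformationTheory Real

/-! ### The Donsker–Varadhan variational formula. -/

section DonskerVaradhan

variable {Ω : Type*} [MeasurableSpace Ω] {μ ν : Measure Ω}
  [IsProbabilityMeasure μ] [IsProbabilityMeasure ν]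

lemma integrable_of_abs_le {μ : Measure Ω} [IsFiniteMeasure μ] {f : Ω → ℝ} (hf : Measurable f)
    {M : ℝ} (hM : ∀ x, |f x| ≤ M) : Integrable f μ :=
  Integrable.of_bound hf.aestronglyMeasurable M (ae_of_all _ hM)

lemma integrable_exp_of_abs_le {μ : Measure Ω} [IsFiniteMeasure μ] {f : Ω → ℝ} (hf : Measurable f)
    {M : ℝ} (hM : ∀ x, |f x| ≤ M) : Integrable (fun x => exp (f x)) μ :=
  integrable_of_abs_le (M := exp M) (by fun_prop) fun x => by
    rw [abs_of_pos (exp_pos _)]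
    exact exp_le_exp.2 ((le_abs_self _).trans (hM x))

/-- The easy half of the Donsker-Varadhan variational formula. -/
lemma integral_sub_log_integral_exp_le_toReal_klDiv (h : klDiv μ ν ≠ ∞) {f : Ω → ℝ}
    (hf : Measurable f) {M : ℝ} (hM : ∀ x, |f x| ≤ M) :
    ∫ x, f x ∂μ - log (∫ x, exp (f x) ∂ν) ≤ (klDiv μ ν).toReal := by
  obtain ⟨hac, hint⟩ := klDiv_ne_top_iff.1 h
  have hfμ : Integrable f μ := integrable_of_abs_le hf hM
  have hexp : Integrable (fun x => exp (f x)) ν := integrable_exp_of_abs_le hf hM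
  -- The difference of the two sides is the relative entropy of `μ` with respect to the tilted
  -- measure `ν.tilted f`, which is nonnegative.
  have h1 := integral_llr_tilted_right hac hfμ hexp hint
  have : IsProbabilityMeasure (ν.tilted f) := isProbabilityMeasure_tilted hexp
  have h2 := integral_llr_add_sub_measure_univ_nonneg
    (hac.trans (absolutelyContinuous_tilted hexp)) (integrable_llr_tilted_right hac hfμ hint hexp)
  rw [toReal_klDiv_of_measure_eq hac (by simp)]
  simp at h2
  linarith

/-- With `t` the truncation of `g` to `[1/n, n]`, the expression is `(t log t + 1 - t) + (g - t) log
t`. The last product is nonnegative: `g > t` forces `t = n ≥ 1`, and `g < t` forces `t = 1/n ≤ 1`.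
This nonnegativity is what makes Fatou's lemma applicable below. -/
lemma klFun_truncation_nonneg {g n : ℝ} (hg : 0 ≤ g) (hn : 1 ≤ n) :
    0 ≤ g * log (max n⁻¹ (min g n)) + 1 - max n⁻¹ (min g n) := by
  have hn0 : 0 < n := by linarith
  have hninv : n⁻¹ ≤ 1 := inv_le_one_of_one_le₀ hn
  have hkl : ∀ x : ℝ, 0 ≤ x → 0 ≤ x * log x + 1 - x := fun x hx => klFun_nonneg hx
  rcases le_total g n with h | h
  · rw [min_eq_left h]
    rcases le_total n⁻¹ g with h' | h'
    · rw [max_eq_right h']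
      exact hkl g hg
    · rw [max_eq_left h']
      have hlog : log n⁻¹ ≤ 0 := log_nonpos (by positivity) hninv
      have := hkl n⁻¹ (by positivity)
      nlinarith
  · rw [min_eq_right h, max_eq_right (hninv.trans hn)]
    have hlog : 0 ≤ log n := log_nonneg hn
    have := hkl n hn0.le
    nlinarith

lemma tendsto_klFun_truncation {g : ℝ} (hg : 0 ≤ g) :
    Tendsto (fun n : ℕ => g * log (max ((n : ℝ) + 1)⁻¹ (min g ((n : ℝ) + 1))) + 1
      - max ((n : ℝ) + 1)⁻¹ (min g ((n : ℝ) + 1))) atTop (𝓝 (klFun g)) := by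
  have hinv : Tendsto (fun n : ℕ => ((n : ℝ) + 1)⁻¹) atTop (𝓝 0) := by
    simpa [one_div] using tendsto_one_div_add_atTop_nhds_zero_nat (𝕜 := ℝ)
  have hmin : ∀ᶠ n : ℕ in atTop, min g ((n : ℝ) + 1) = g := by
    obtain ⟨N, hN⟩ := exists_nat_ge g
    filter_upwards [eventually_ge_atTop N] with n hn
    have : (N : ℝ) ≤ n := by exact_mod_cast hn
    exact min_eq_left (by linarith)
  have hmax : Tendsto (fun n : ℕ => max ((n : ℝ) + 1)⁻¹ (min g ((n : ℝ) + 1))) atTop (𝓝 g) := by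
    have h1 : Tendsto (fun n : ℕ => min g ((n : ℝ) + 1)) atTop (𝓝 g) :=
      tendsto_const_nhds.congr' (hmin.mono fun n h => h.symm)
    simpa [max_eq_right hg] using hinv.max h1
  rcases hg.eq_or_lt with rfl | hpos
  · simpa [klFun] using (tendsto_const_nhds (x := (1 : ℝ))).sub hmax
  · have := (((hmax.log hpos.ne').const_mul g).add_const 1).sub hmax
    simpa [klFun] using this

/-- The hard half of the Donsker-Varadhan variational formula. -/
lemma klDiv_le_of_forall_integral_sub_log_le {C : ℝ}
    (h : ∀ f : Ω → ℝ, Measurable f → (∃ M, ∀ x, |f x| ≤ M) →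
      ∫ x, f x ∂μ - log (∫ x, exp (f x) ∂ν) ≤ C) :
    klDiv μ ν ≤ ENNReal.ofReal C := by
  have hac : μ ≪ ν := by
    refine Measure.AbsolutelyContinuous.mk fun s hs hνs => ?_
    by_contra hμs
    have hpos : 0 < μ.real s := by
      rw [measureReal_def]
      exact ENNReal.toReal_pos hμs (measure_ne_top _ _)
    -- On a `ν`-null set `s` the test function `n · 1_s` has exponential moment one, so `n μ(s)`
    -- stays bounded in `n`.
    have key : ∀ n : ℕ, n * μ.real s ≤ C := fun n => by
      have h1 := h (s.indicator fun _ => (n : ℝ)) (measurable_const.indicator hs)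
        ⟨n, fun x => by
          by_cases hx : x ∈ s <;> simp [hx]⟩
      have h2 : ∫ x, exp (s.indicator (fun _ => (n : ℝ)) x) ∂ν = 1 := by
        have : (fun x => exp (s.indicator (fun _ => (n : ℝ)) x)) =ᵐ[ν] fun _ => 1 := by
          filter_upwards [measure_eq_zero_iff_ae_notMem.1 hνs] with x hx
          simp [hx]
        rw [integral_congr_ae this]
        simp
      rw [h2, integral_indicator hs] at h1
      simp at h1
      linarith
    obtain ⟨n, hn⟩ := exists_nat_gt (C / μ.real s)
    rw [div_lt_iff₀ hpos] at hn
    linarith [key n]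
  rw [klDiv_eq_lintegral_klFun_of_ac hac]
  set g : Ω → ℝ := fun x => (μ.rnDeriv ν x).toReal with hg_def
  have hg : Measurable g := (Measure.measurable_rnDeriv μ ν).ennreal_toReal
  have hg0 : ∀ x, 0 ≤ g x := fun x => ENNReal.toReal_nonneg
  -- The optimal test function is the logarithm of the density `g`. Truncating `g` to `[1/(n+1),
  -- n+1]` makes it bounded, and Fatou's lemma removes the truncation.
  let t : ℕ → Ω → ℝ := fun n x => max ((n : ℝ) + 1)⁻¹ (min (g x) ((n : ℝ) + 1))
  have ht : ∀ n, Measurable (t n) := fun n => by unfold t; fun_prop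
  have htpos : ∀ n x, 0 < t n x := fun n x => lt_max_of_lt_left (by positivity)
  have ht_le : ∀ n x, t n x ≤ (n : ℝ) + 1 := fun n x =>
    max_le ((inv_le_one_of_one_le₀ (by linarith [n.cast_nonneg (α := ℝ)])).trans
      (by linarith [n.cast_nonneg (α := ℝ)])) (min_le_right _ _)
  have ht_ge : ∀ (n : ℕ) x, ((n : ℝ) + 1)⁻¹ ≤ t n x := fun n x => le_max_left _ _
  have hlogb : ∀ n x, |log (t n x)| ≤ log ((n : ℝ) + 1) := fun n x => by
    rw [abs_le]
    constructor
    · rw [← log_inv]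
      exact log_le_log (by positivity) (ht_ge n x)
    · exact log_le_log (htpos n x) (ht_le n x)
  have hbound : ∀ n, ∫⁻ x, ENNReal.ofReal (g x * log (t n x) + 1 - t n x) ∂ν
      ≤ ENNReal.ofReal C := fun n => by
    have hgint : Integrable g ν := Measure.integrable_toReal_rnDeriv
    have hglog : Integrable (fun x => g x * log (t n x)) ν :=
      hgint.mul_bdd (c := log ((n : ℝ) + 1)) (ht n).log.aestronglyMeasurable
        (ae_of_all _ fun x => hlogb n x)
    have htint : Integrable (t n) ν := integrable_of_abs_le (M := (n : ℝ) + 1) (ht n)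
      fun x => by rw [abs_of_pos (htpos n x)]; exact ht_le n x
    have hint : Integrable (fun x => g x * log (t n x) + 1 - t n x) ν :=
      (hglog.add (integrable_const 1)).sub htint
    rw [← ofReal_integral_eq_lintegral_ofReal hint (ae_of_all _ fun x =>
      klFun_truncation_nonneg (hg0 x) (by linarith [n.cast_nonneg (α := ℝ)]))]
    refine ENNReal.ofReal_le_ofReal ?_
    have h1 := h (fun x => log (t n x)) (by fun_prop) ⟨_, hlogb n⟩
    have h2 : ∫ x, exp (log (t n x)) ∂ν = ∫ x, t n x ∂ν :=
      integral_congr_ae (ae_of_all _ fun x => exp_log (htpos n x))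
    have h3 : ∫ x, log (t n x) ∂μ = ∫ x, g x * log (t n x) ∂ν := by
      rw [← integral_rnDeriv_smul hac]
      rfl
    have hZ : 0 < ∫ x, t n x ∂ν := by
      refine lt_of_lt_of_le (b := ∫ _, ((n : ℝ) + 1)⁻¹ ∂ν) ?_ ?_
      · simp
        positivity
      · exact integral_mono (integrable_const _) htint (ht_ge n)
    rw [h2, h3] at h1
    have h4 : ∫ x, (g x * log (t n x) + 1 - t n x) ∂ν
        = ∫ x, g x * log (t n x) ∂ν + 1 - ∫ x, t n x ∂ν := by
      rw [integral_sub (f := fun x => g x * log (t n x) + 1) (hglog.add (integrable_const 1)) htint,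
        integral_add hglog (integrable_const 1)]
      simp
    rw [h4]
    -- With `Z = ∫ t dν`, the inequality `log Z ≤ Z - 1` replaces the logarithmic normalization by
    -- the linear one occurring in `klFun`.
    linarith [log_le_sub_one_of_pos hZ]
  calc ∫⁻ x, ENNReal.ofReal (klFun (g x)) ∂ν
      = ∫⁻ x, liminf (fun n => ENNReal.ofReal (g x * log (t n x) + 1 - t n x)) atTop ∂ν := by
        refine lintegral_congr fun x => ?_
        exact ((ENNReal.continuous_ofReal.tendsto _).comp
          (tendsto_klFun_truncation (hg0 x))).liminf_eq.symm
    _ ≤ liminf (fun n => ∫⁻ x, ENNReal.ofReal (g x * log (t n x) + 1 - t n x) ∂ν) atTop :=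
        lintegral_liminf_le fun n => by fun_prop
    _ ≤ ENNReal.ofReal C := by
        refine (liminf_le_liminf (Eventually.of_forall hbound)).trans ?_
        simp

end DonskerVaradhan

/-! ### Convexity, superadditivity and approximation of the relative entropy. -/

section Consequences

variable {Ω : Type*} [MeasurableSpace Ω]

/-- The relative entropy is convex in its first argument, with respect to countable mixtures. -/
lemma klDiv_sum_smul_le {ι : Type*} [Countable ι] {c : ι → ℝ≥0∞} (hc : ∑' i, c i = 1)
    {μ : ι → Measure Ω} [∀ i, IsProbabilityMeasure (μ i)] {ν : Measure Ω}
    [IsProbabilityMeasure ν] :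
    klDiv (Measure.sum fun i => c i • μ i) ν ≤ ∑' i, c i * klDiv (μ i) ν := by
  by_cases htop : ∑' i, c i * klDiv (μ i) ν = ∞
  · simp [htop]
  have : IsProbabilityMeasure (Measure.sum fun i => c i • μ i) := ⟨by
    rw [Measure.sum_apply _ MeasurableSet.univ]
    simp [hc]⟩
  have hcne : ∀ i, c i ≠ ∞ := fun i => ENNReal.ne_top_of_tsum_ne_top (hc ▸ ENNReal.one_ne_top) i
  have hcsum : HasSum (fun i => (c i).toReal) 1 := by
    have := ENNReal.hasSum_toReal (f := c) (hc ▸ ENNReal.one_ne_top)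
    simpa [← ENNReal.tsum_toReal_eq hcne, hc] using this
  rw [← ENNReal.ofReal_toReal htop]
  refine klDiv_le_of_forall_integral_sub_log_le fun f hf ⟨M, hM⟩ => ?_
  -- For fixed `f` the variational functional is affine in the first measure, so the mixture is
  -- handled summand by summand.
  have h1 := hasSum_integral_measure (μ := fun i => c i • μ i) (f := f)
    (integrable_of_abs_le hf hM)
  simp only [integral_smul_measure, smul_eq_mul] at h1
  have h2 := (h1.sub (hcsum.mul_right (log (∫ x, exp (f x) ∂ν))))
  rw [one_mul] at h2
  have h3 := ENNReal.hasSum_toReal htop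
  rw [← ENNReal.tsum_toReal_eq (ENNReal.ne_top_of_tsum_ne_top htop)] at h3
  refine hasSum_le (fun i => ?_) h2 h3
  by_cases hci : c i = 0
  · simp [hci]
  have hk : klDiv (μ i) ν ≠ ∞ := fun hk => ENNReal.ne_top_of_tsum_ne_top htop i
    (by rw [hk, ENNReal.mul_top hci])
  rw [ENNReal.toReal_mul, ← mul_sub]
  exact mul_le_mul_of_nonneg_left (integral_sub_log_integral_exp_le_toReal_klDiv hk hf hM)
    ENNReal.toReal_nonneg

open ProbabilityTheory in
/-- The relative entropy with respect to a product measure is superadditive. -/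
lemma klDiv_fst_add_klDiv_snd_le {X Y : Type*} [MeasurableSpace X] [MeasurableSpace Y]
    [StandardBorelSpace Y] [Nonempty Y] {ρ : Measure (X × Y)} [IsProbabilityMeasure ρ]
    {α : Measure X} {β : Measure Y} [IsProbabilityMeasure α] [IsProbabilityMeasure β] :
    klDiv ρ.fst α + klDiv ρ.snd β ≤ klDiv ρ (α.prod β) := by
  -- Chain rule: the entropy of the first marginal plus that of `ρ` against `ρ.fst.prod β`.
  -- Projecting the latter to the second factor can only decrease it.
  have h := klDiv_compProd_eq_add ρ.fst α ρ.condKernel (Kernel.const X β)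
  rw [ρ.disintegrate, Measure.compProd_const] at h
  rw [h]
  gcongr
  have h2 := klDiv_map_le (μ := ρ) (ν := ρ.fst ⊗ₘ Kernel.const X β) (g := Prod.snd) measurable_snd
  rw [Measure.compProd_const] at h2 ⊢
  have h3 : (ρ.fst.prod β).map Prod.snd = β := by
    rw [Measure.map_snd_prod]
    simp
  rw [h3] at h2
  exact h2

open ProbabilityTheory in
lemma klDiv_map_add_klDiv_map_le {X Y : Type*} [MeasurableSpace X] [MeasurableSpace Y]
    [StandardBorelSpace Y] [Nonempty Y] {μ ν : Measure Ω} [IsProbabilityMeasure μ]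
    [IsProbabilityMeasure ν] {f : Ω → X} {g : Ω → Y} (hf : Measurable f) (hg : Measurable g)
    (hind : IndepFun f g ν) :
    klDiv (μ.map f) (ν.map f) + klDiv (μ.map g) (ν.map g)
      ≤ klDiv (μ.map fun ω => (f ω, g ω)) (ν.map fun ω => (f ω, g ω)) := by
  have := Measure.isProbabilityMeasure_map (μ := ν) hf.aemeasurable
  have := Measure.isProbabilityMeasure_map (μ := ν) hg.aemeasurable
  have := Measure.isProbabilityMeasure_map (μ := μ) (hf.prodMk hg).aemeasurable
  rw [(indepFun_iff_map_prod_eq_prod_map_map hf.aemeasurable hg.aemeasurable).1 hind]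
  have := klDiv_fst_add_klDiv_snd_le (ρ := μ.map fun ω => (f ω, g ω)) (α := ν.map f)
    (β := ν.map g)
  rwa [Measure.fst_map_prodMk hg, Measure.snd_map_prodMk hf] at this

lemma abs_clamp_le (M y : ℝ) : |max (-M) (min M y)| ≤ |M| := by
  rw [abs_le]
  constructor
  · exact le_trans (neg_le_neg (le_abs_self M)) (le_max_left _ _)
  · exact max_le (neg_le_abs M) ((min_le_left _ _).trans (le_abs_self M))

lemma clamp_eq_self {M y : ℝ} (h : |y| ≤ M) : max (-M) (min M y) = y := by
  rw [abs_le] at h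
  rw [min_eq_right h.2, max_eq_right h.1]

/-- The relative entropy is the limit of those of finer and finer images that generate the whole
σ-algebra. -/
lemma klDiv_le_of_forall_klDiv_map_le {Ω : Type*} [mΩ : MeasurableSpace Ω] {Y : ℕ → Type*}
    [∀ n, MeasurableSpace (Y n)] {g : ∀ n, Ω → Y n} (hg : ∀ n, Measurable (g n))
    (hmono : Monotone fun n => MeasurableSpace.comap (g n) inferInstance)
    (hsup : mΩ ≤ ⨆ n, MeasurableSpace.comap (g n) inferInstance)
    {μ ν : Measure Ω} [IsProbabilityMeasure μ] [IsProbabilityMeasure ν] {C : ℝ≥0∞}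
    (h : ∀ n, klDiv (μ.map (g n)) (ν.map (g n)) ≤ C) : klDiv μ ν ≤ C := by
  by_cases hC : C = ∞
  · simp [hC]
  rw [← ENNReal.ofReal_toReal hC]
  refine klDiv_le_of_forall_integral_sub_log_le fun f hf ⟨M, hM⟩ => ?_
  let ℱ : Filtration ℕ mΩ :=
    ⟨fun n => MeasurableSpace.comap (g n) inferInstance, hmono, fun n => (hg n).comap_le⟩
  have hfm : StronglyMeasurable[⨆ n, ℱ n] f := by
    have : mΩ = ⨆ n, ℱ n := le_antisymm hsup (iSup_le fun n => ℱ.le n)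
    rw [← this]
    exact hf.stronglyMeasurable
  -- Conditioning under `μ + ν` yields one sequence of test functions that converges almost
  -- everywhere for both measures.
  have hlim := Integrable.tendsto_ae_condExp (ℱ := ℱ) (μ := μ + ν)
    (integrable_of_abs_le hf hM) hfm
  choose F hF hFeq using fun n => StronglyMeasurable.exists_eq_measurable_comp
    (stronglyMeasurable_condExp (m := ℱ n) (μ := μ + ν) (f := f))
  -- The factor `F n` of the conditional expectation need not be bounded off the range of `g n`.
  -- Clamping restores the bound and leaves the limit unchanged.
  let φ : ∀ n, Y n → ℝ := fun n y => max (-M) (min M (F n y))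
  have hφ : ∀ n, Measurable (φ n) := fun n => by
    have := (hF n).measurable
    fun_prop
  have hφb : ∀ n y, |φ n y| ≤ |M| := fun n y => abs_clamp_le _ _
  have hlim' : ∀ᵐ x ∂(μ + ν), Tendsto (fun n => φ n (g n x)) atTop (𝓝 (f x)) := by
    filter_upwards [hlim] with x hx
    have h1 : Tendsto (fun n => max (-M) (min M (((μ + ν)[f | ℱ n]) x))) atTop
        (𝓝 (max (-M) (min M (f x)))) := tendsto_const_nhds.max (tendsto_const_nhds.min hx)
    rw [clamp_eq_self (hM x)] at h1
    refine h1.congr fun n => ?_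
    rw [hFeq n]
    rfl
  rw [ae_add_measure_iff] at hlim'
  have hφg : ∀ n, Measurable fun x => φ n (g n x) := fun n => (hφ n).comp (hg n)
  have hI1 : Tendsto (fun n => ∫ x, φ n (g n x) ∂μ) atTop (𝓝 (∫ x, f x ∂μ)) :=
    tendsto_integral_of_dominated_convergence (fun _ => |M|)
      (fun n => (hφg n).aestronglyMeasurable) (integrable_const _)
      (fun n => ae_of_all _ fun x => hφb n _) hlim'.1
  have hI2 : Tendsto (fun n => ∫ x, exp (φ n (g n x)) ∂ν) atTop (𝓝 (∫ x, exp (f x) ∂ν)) :=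
    tendsto_integral_of_dominated_convergence (fun _ => exp |M|)
      (fun n => (hφg n).exp.aestronglyMeasurable) (integrable_const _)
      (fun n => ae_of_all _ fun x => by
        rw [norm_eq_abs, abs_of_pos (exp_pos _)]
        exact exp_le_exp.2 ((le_abs_self _).trans (hφb n _)))
      (hlim'.2.mono fun x hx => (continuous_exp.tendsto _).comp hx)
  have hZ : 0 < ∫ x, exp (f x) ∂ν := integral_exp_pos (integrable_exp_of_abs_le hf hM)
  refine le_of_tendsto (hI1.sub (hI2.log hZ.ne')) (Eventually.of_forall fun n => ?_)
  have := Measure.isProbabilityMeasure_map (μ := ν) (hg n).aemeasurable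
  have := Measure.isProbabilityMeasure_map (μ := μ) (hg n).aemeasurable
  have h1 := integral_sub_log_integral_exp_le_toReal_klDiv (ne_top_of_le_ne_top hC (h n)) (hφ n)
    (hφb n)
  rw [integral_map (hg n).aemeasurable (hφ n).aestronglyMeasurable,
    integral_map (hg n).aemeasurable (hφ n).exp.aestronglyMeasurable] at h1
  exact h1.trans (ENNReal.toReal_mono hC (h n))

end Consequences

end BoxBoseGas

/-! ### Block entropies of stationary laws and existence of the entropy density. -/

namespace BoxBoseGas

open InformationTheory

variable {d : ℕ}

/-- The restriction of a configuration to a set of coordinates. -/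
abbrev coords (A : Set (Site d × ℕ+)) (ω : Config d) : A → ℕ := fun a => ω a

lemma measurable_coords (A : Set (Site d × ℕ+)) : Measurable (coords A) :=
  measurable_pi_lambda _ fun a => measurable_pi_apply a.1

section Poisson

instance isProbabilityMeasure_poissonProcess (m : ℕ+ → ℝ≥0) :
    IsProbabilityMeasure (poissonProcess d m) := by
  unfold poissonProcess
  infer_instance

lemma measurable_shift (z : Site d) : Measurable (shift z) :=
  measurable_pi_lambda _ fun p => measurable_pi_apply (p.1 + z, p.2)

lemma poissonProcess_mem_stationary (m : ℕ+ → ℝ≥0) : poissonProcess d m ∈ stationary d := by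
  refine ⟨inferInstance, fun z => ?_⟩
  have h := Measure.infinitePi_map_piCongrLeft
    (fun p : Site d × ℕ+ => ProbabilityTheory.poissonMeasure (m p.2))
    ((Equiv.addRight (-z)).prodCongr (Equiv.refl ℕ+))
  unfold poissonProcess
  refine Eq.trans ?_ h
  refine congrArg₂ _ (funext fun ω => funext fun p => ?_) rfl
  obtain ⟨p, rfl⟩ := ((Equiv.addRight (-z)).prodCongr (Equiv.refl ℕ+)).surjective p
  rw [MeasurableEquiv.coe_piCongrLeft, Equiv.piCongrLeft_apply_apply]
  simp [shift]

lemma indepFun_restrict (m : ℕ+ → ℝ≥0) {A B : Set (Site d × ℕ+)} (hAB : Disjoint A B) :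
    ProbabilityTheory.IndepFun (coords A) (coords B) (poissonProcess d m) := by
  have h : ProbabilityTheory.iIndepFun (fun (p : Site d × ℕ+) (ω : Config d) => ω p)
      (poissonProcess d m) :=
    ProbabilityTheory.iIndepFun_infinitePi (X := fun _ x => x) fun _ => measurable_id
  have h2 := ProbabilityTheory.indep_iSup_of_disjoint
    (fun p => (measurable_pi_apply p).comap_le) h hAB
  have hle : ∀ C : Set (Site d × ℕ+),
      MeasurableSpace.comap (coords C) inferInstance
        ≤ ⨆ p ∈ C, MeasurableSpace.comap (fun ω : Config d => ω p) inferInstance := fun C => by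
    refine measurable_iff_comap_le.1 ?_
    refine @measurable_pi_lambda _ _ _ (_) _ _ fun p => ?_
    refine measurable_iff_comap_le.2 ?_
    exact le_iSup₂_of_le p.1 p.2 le_rfl
  exact ProbabilityTheory.indep_of_indep_of_le_left
    (ProbabilityTheory.indep_of_indep_of_le_right h2 (hle B)) (hle A)

end Poisson

/-- The relative entropy of the projections to the coordinates in `A`, with respect to the Poisson
process with intensities `m`. -/
noncomputable def blockEntropy (m : ℕ+ → ℝ≥0) (P : Measure (Config d))
    (A : Set (Site d × ℕ+)) : ℝ≥0∞ :=
  klDiv (P.map (coords A)) ((poissonProcess d m).map (coords A))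

lemma boxEntropy_eq (m : ℕ+ → ℝ≥0) (P : Measure (Config d)) (n : ℕ) :
    boxEntropy m P n = blockEntropy m P {p | p.1 ∈ box d n} / ((box d n).card : ℝ≥0∞) := rfl

lemma klDiv_map_comp_le {Ω X Y : Type*} [MeasurableSpace Ω] [MeasurableSpace X]
    [MeasurableSpace Y] {μ ν : Measure Ω} [IsFiniteMeasure μ] [IsFiniteMeasure ν] {f : Ω → X}
    {g : X → Y} (hg : Measurable g) (hf : Measurable f) :
    klDiv (μ.map (g ∘ f)) (ν.map (g ∘ f)) ≤ klDiv (μ.map f) (ν.map f) := by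
  rw [← Measure.map_map hg hf, ← Measure.map_map hg hf]
  exact klDiv_map_le _ _ hg

section Block

variable (m : ℕ+ → ℝ≥0) {P : Measure (Config d)} {A B : Set (Site d × ℕ+)}

lemma blockEntropy_mono [IsProbabilityMeasure P] (h : A ⊆ B) :
    blockEntropy m P A ≤ blockEntropy m P B :=
  klDiv_map_comp_le (g := fun (η : B → ℕ) (a : A) => η ⟨a, h a.2⟩) (f := coords B)
    (by fun_prop) (measurable_coords B)

lemma blockEntropy_add_le [IsProbabilityMeasure P] (h : Disjoint A B) :
    blockEntropy m P A + blockEntropy m P B ≤ blockEntropy m P (A ∪ B) :=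
  (klDiv_map_add_klDiv_map_le (μ := P) (measurable_coords A) (measurable_coords B)
    (indepFun_restrict m h)).trans
  (klDiv_map_comp_le (g := fun η : ↥(A ∪ B) → ℕ =>
    ((fun a : A => η ⟨a, Or.inl a.2⟩), fun b : B => η ⟨b, Or.inr b.2⟩)) (f := coords (A ∪ B))
    (by fun_prop) (measurable_coords _))

lemma sum_blockEntropy_le [IsProbabilityMeasure P] {ι : Type*} (s : Finset ι)
    (C : ι → Set (Site d × ℕ+)) (hC : (s : Set ι).PairwiseDisjoint C) :
    ∑ i ∈ s, blockEntropy m P (C i) ≤ blockEntropy m P (⋃ i ∈ s, C i) := by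
  classical
  induction s using Finset.induction_on with
  | empty => simp
  | insert i s hi ih =>
    rw [Finset.sum_insert hi, Finset.set_biUnion_insert]
    refine (add_le_add_right (ih (hC.subset (by simp))) _).trans (blockEntropy_add_le m ?_)
    rw [Set.disjoint_iUnion₂_right]
    exact fun j hj => hC (by simp) (by simp [hj]) fun h => hi (h ▸ hj)

/-- Both `P` and the Poisson process are shift-invariant, so the law on `A` is an image of the law
on the translated block. The one inequality suffices for the tiling argument. -/
lemma blockEntropy_le_shift (hP : P ∈ stationary d) (z : Site d) :
    blockEntropy m P A ≤ blockEntropy m P {p | (p.1 - z, p.2) ∈ A} := by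
  have := hP.1
  have hz : ∀ Q ∈ stationary d, Q.map (coords A) = Q.map (fun ω (a : A) => ω (a.1.1 + z, a.1.2)) :=
    fun Q hQ => by
      conv_lhs => rw [← hQ.2 z]
      rw [Measure.map_map (measurable_coords A) (measurable_shift z)]
      rfl
  unfold blockEntropy
  rw [hz P hP, hz _ (poissonProcess_mem_stationary m)]
  exact klDiv_map_comp_le (g := fun (η : {p : Site d × ℕ+ | (p.1 - z, p.2) ∈ A} → ℕ) (a : A) =>
    η ⟨(a.1.1 + z, a.1.2), by simp⟩) (by fun_prop) (measurable_coords _)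

end Block

section Box

lemma mem_box {n : ℕ} {x : Site d} : x ∈ box d n ↔ ∀ i, |x i| ≤ n := by
  simp [box, Pi.le_def, abs_le, forall_and]

lemma card_box (n : ℕ) : (box d n).card = (2 * n + 1) ^ d := by
  unfold box
  rw [Pi.card_Icc]
  simp
  congr 1
  omega

/-- Disjoint translates of the box of radius `n` inside the box of radius `N`. -/
lemma card_mul_blockEntropy_box_le (m : ℕ+ → ℝ≥0) {P : Measure (Config d)} (hP : P ∈ stationary d)
    {n r N : ℕ} (hN : (2 * n + 1) * r + n ≤ N) :
    ((2 * r + 1) ^ d : ℕ) * blockEntropy m P {p | p.1 ∈ box d n}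
      ≤ blockEntropy m P {p | p.1 ∈ box d N} := by
  have := hP.1
  -- Boxes of side `2n + 1` centred at the points of `(2n + 1)ℤ^d` tile the lattice. Those with
  -- index in the box of radius `r` fill the box of radius `(2n + 1) r + n`.
  let C : Site d → Set (Site d × ℕ+) := fun j =>
    {p | p.1 - (fun i => (2 * (n : ℤ) + 1) * j i) ∈ box d n}
  have hdisj : ((box d r : Finset (Site d)) : Set (Site d)).PairwiseDisjoint C := by
    intro j _ j' _ hjj
    refine Set.disjoint_left.2 fun p hp hp' => hjj (funext fun i => ?_)
    have h1 := mem_box.1 hp i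
    have h2 := mem_box.1 hp' i
    simp only [Pi.sub_apply, abs_le] at h1 h2
    by_contra hne
    rcases lt_or_gt_of_ne hne with h | h <;> nlinarith
  have hsub : (⋃ j ∈ box d r, C j) ⊆ {p | p.1 ∈ box d N} := by
    refine Set.iUnion₂_subset fun j hj p hp => mem_box.2 fun i => ?_
    have h1 := mem_box.1 hp i
    have h2 := mem_box.1 hj i
    have h3 : (2 * (n : ℤ) + 1) * r + n ≤ N := by exact_mod_cast hN
    simp only [Pi.sub_apply, abs_le] at h1 h2 ⊢
    constructor <;> nlinarith
  calc ((2 * r + 1) ^ d : ℕ) * blockEntropy m P {p | p.1 ∈ box d n}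
      = ∑ _j ∈ box d r, blockEntropy m P {p | p.1 ∈ box d n} := by
        rw [Finset.sum_const, card_box, nsmul_eq_mul]
    _ ≤ ∑ j ∈ box d r, blockEntropy m P (C j) := Finset.sum_le_sum fun j _ =>
        blockEntropy_le_shift m hP _
    _ ≤ blockEntropy m P (⋃ j ∈ box d r, C j) := sum_blockEntropy_le m _ _ hdisj
    _ ≤ _ := blockEntropy_mono m hsub

/-- The prefactor is the fraction of the box of radius `N` that the translates cover. -/
lemma mul_boxEntropy_le (m : ℕ+ → ℝ≥0) {P : Measure (Config d)} (hP : P ∈ stationary d)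
    {n r N : ℕ} (hN : (2 * n + 1) * r + n ≤ N) :
    ENNReal.ofReal ((((2 * r + 1) * (2 * n + 1) : ℝ) / (2 * N + 1)) ^ d) * boxEntropy m P n
      ≤ boxEntropy m P N := by
  rw [boxEntropy_eq, boxEntropy_eq]
  refine le_trans (le_of_eq ?_)
    (ENNReal.div_le_div_right (card_mul_blockEntropy_box_le m hP hN) _)
  rw [card_box, card_box]
  have h1 : ENNReal.ofReal ((((2 * r + 1) * (2 * n + 1) : ℝ) / (2 * N + 1)) ^ d)
      = ((2 * r + 1) ^ d : ℕ) * ((2 * n + 1) ^ d : ℕ) / ((2 * N + 1) ^ d : ℕ) := by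
    rw [div_pow, mul_pow, ENNReal.ofReal_div_of_pos (by positivity),
      ENNReal.ofReal_mul (by positivity)]
    congr 1
    · congr 1
      · rw [← ENNReal.ofReal_natCast]; push_cast; rfl
      · rw [← ENNReal.ofReal_natCast]; push_cast; rfl
    · rw [← ENNReal.ofReal_natCast]; push_cast; rfl
  rw [h1]
  have h2 : (((2 * n + 1) ^ d : ℕ) : ℝ≥0∞) * (((2 * n + 1) ^ d : ℕ) : ℝ≥0∞)⁻¹ = 1 :=
    ENNReal.mul_inv_cancel (by simp) (ENNReal.natCast_ne_top _)
  simp only [div_eq_mul_inv]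
  calc _ = ((2 * r + 1) ^ d : ℕ) * blockEntropy m P {p | p.1 ∈ box d n}
      * (((2 * N + 1) ^ d : ℕ) : ℝ≥0∞)⁻¹
      * ((((2 * n + 1) ^ d : ℕ) : ℝ≥0∞) * (((2 * n + 1) ^ d : ℕ) : ℝ≥0∞)⁻¹) := by ring
    _ = _ := by rw [h2, mul_one]

lemma boxEntropy_le_liminf (m : ℕ+ → ℝ≥0) {P : Measure (Config d)} (hP : P ∈ stationary d)
    (n : ℕ) : boxEntropy m P n ≤ liminf (boxEntropy m P) atTop := by
  -- The largest `r` for which the translates fit. The uncovered margin in each direction is bounded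
  -- in `N`, so the covered fraction tends to one.
  let r : ℕ → ℕ := fun N => (N - n) / (2 * n + 1)
  have hr : ∀ N, n ≤ N → (2 * n + 1) * r N + n ≤ N ∧ N < (2 * n + 1) * (r N + 1) + n :=
    fun N hN => by
      have h1 := Nat.div_add_mod (N - n) (2 * n + 1)
      have h2 := Nat.mod_lt (N - n) (show 0 < 2 * n + 1 by omega)
      change (2 * n + 1) * r N + (N - n) % (2 * n + 1) = N - n at h1
      rw [mul_add, mul_one]
      omega
  have hlim : Tendsto (fun N : ℕ => ((2 * r N + 1) * (2 * n + 1) : ℝ) / (2 * N + 1)) atTop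
      (𝓝 1) := by
    have hlow : Tendsto (fun N : ℕ => 1 - (4 * n + 2 : ℝ) * (1 / ((N : ℝ) + 1))) atTop (𝓝 1) := by
      have := (tendsto_one_div_add_atTop_nhds_zero_nat (𝕜 := ℝ)).const_mul (4 * n + 2 : ℝ)
      simpa using this.const_sub 1
    refine tendsto_of_tendsto_of_tendsto_of_le_of_le' hlow tendsto_const_nhds ?_ ?_
    · filter_upwards [eventually_ge_atTop n] with N hN
      have h2 : (N : ℝ) + 1 ≤ (2 * n + 1) * (r N + 1) + n := by exact_mod_cast (hr N hN).2
      rw [le_div_iff₀ (by positivity)]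
      have h3 : (1 / ((N : ℝ) + 1)) * (2 * N + 1) ≥ 1 := by
        rw [ge_iff_le, div_mul_eq_mul_div, le_div_iff₀ (by positivity)]
        linarith [N.cast_nonneg (α := ℝ)]
      nlinarith [n.cast_nonneg (α := ℝ)]
    · filter_upwards [eventually_ge_atTop n] with N hN
      have h2 : (2 * n + 1) * (r N : ℝ) + n ≤ N := by exact_mod_cast (hr N hN).1
      rw [div_le_one (by positivity)]
      nlinarith
  have hlim2 : Tendsto (fun N : ℕ => ENNReal.ofReal
      ((((2 * r N + 1) * (2 * n + 1) : ℝ) / (2 * N + 1)) ^ d) * boxEntropy m P n) atTop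
      (𝓝 (boxEntropy m P n)) := by
    have h1 := (ENNReal.continuous_ofReal.tendsto _).comp (hlim.pow d)
    have h2 := ENNReal.Tendsto.mul_const (b := boxEntropy m P n) h1 (Or.inl (by simp))
    simpa using h2
  rw [← hlim2.liminf_eq]
  refine liminf_le_liminf ?_
  filter_upwards [eventually_ge_atTop n] with N hN
  exact mul_boxEntropy_le m hP (hr N hN).1

/-- The supremum form gives the existence of the limit, and also the convexity of the entropy
density, since a supremum of convex functionals is convex. -/
lemma entropyDensity_eq_iSup (m : ℕ+ → ℝ≥0) {P : Measure (Config d)} (hP : P ∈ stationary d) :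
    entropyDensity m P = ⨆ n, boxEntropy m P n :=
  le_antisymm (by
    refine (liminf_le_limsup).trans ?_
    exact limsup_le_of_le (h := Eventually.of_forall fun n => le_iSup (boxEntropy m P) n))
    (iSup_le fun n => boxEntropy_le_liminf m hP n)

lemma tendsto_boxEntropy (m : ℕ+ → ℝ≥0) {P : Measure (Config d)} (hP : P ∈ stationary d) :
    Tendsto (boxEntropy m P) atTop (𝓝 (entropyDensity m P)) := by
  refine tendsto_of_le_liminf_of_limsup_le le_rfl ?_
  rw [entropyDensity_eq_iSup m hP]
  exact limsup_le_of_le (h := Eventually.of_forall fun n => le_iSup (boxEntropy m P) n)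

lemma entropyDensity_poissonProcess_self (m : ℕ+ → ℝ≥0) :
    entropyDensity m (poissonProcess d m) = 0 := by
  rw [entropyDensity_eq_iSup m (poissonProcess_mem_stationary m)]
  simp only [boxEntropy_eq, blockEntropy]
  refine ENNReal.iSup_eq_zero.2 fun n => ?_
  have := Measure.isProbabilityMeasure_map (μ := poissonProcess d m)
    (f := coords {p : Site d × ℕ+ | p.1 ∈ box d n}) (measurable_coords _).aemeasurable
  rw [klDiv_self]
  simp

end Box

end BoxBoseGas

/-! ### Changing the Poisson intensities; Poisson moments. -/

namespace BoxBoseGas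

open InformationTheory Real

/-- Change of the reference measure in the relative entropy. -/
lemma klDiv_eq_ofReal_integral_add {Ω : Type*} [MeasurableSpace Ω] {μ ν ν' : Measure Ω}
    [IsProbabilityMeasure μ] [IsProbabilityMeasure ν] [IsProbabilityMeasure ν'] {g : Ω → ℝ≥0∞}
    (hg : Measurable g) (hν' : ν' = ν.withDensity g) (hg0 : ∀ᵐ x ∂μ, g x ≠ 0) {L : Ω → ℝ}
    (hL : ∀ᵐ x ∂μ, log (g x).toReal = L x) (hLint : Integrable L μ) (hL0 : 0 ≤ ∫ x, L x ∂μ) :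
    klDiv μ ν = ENNReal.ofReal (∫ x, L x ∂μ) + klDiv μ ν' := by
  have hν'ν : ν' ≪ ν := hν' ▸ withDensity_absolutelyContinuous ν g
  by_cases hac : μ ≪ ν
  swap
  · rw [klDiv_of_not_ac hac, klDiv_of_not_ac fun h => hac (h.trans hν'ν), add_top]
  -- A `ν'`-null set lies `ν`-almost everywhere in `{g = 0}`, which `μ` does not charge.
  have hac' : μ ≪ ν' := by
    refine Measure.AbsolutelyContinuous.mk fun s hs h0 => ?_
    rw [hν', withDensity_apply _ hs, lintegral_eq_zero_iff hg, EventuallyEq,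
      ae_restrict_iff' hs] at h0
    rw [measure_eq_zero_iff_ae_notMem]
    filter_upwards [hac.ae_le h0, hg0] with x hx1 hx2 hxs using hx2 (hx1 hxs)
  have hllr : llr μ ν =ᵐ[μ] fun x => L x + llr μ ν' x := by
    have h1 : μ.rnDeriv ν' * ν'.rnDeriv ν =ᵐ[μ] μ.rnDeriv ν :=
      hac.ae_le (Measure.rnDeriv_mul_rnDeriv hac')
    have h2 : ν'.rnDeriv ν =ᵐ[μ] g := by
      refine hac.ae_le ?_
      rw [hν']
      exact Measure.rnDeriv_withDensity ν hg
    filter_upwards [h1, h2, hL, hg0, hac.ae_le (Measure.rnDeriv_lt_top ν' ν),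
      Measure.rnDeriv_pos hac', hac'.ae_le (Measure.rnDeriv_lt_top μ ν')]
      with x hx1 hx2 hx3 hx4 hx5 hx6 hx7
    rw [llr, llr, ← hx1, Pi.mul_apply, ENNReal.toReal_mul, hx2, Real.log_mul, hx3, add_comm]
    · exact (ENNReal.toReal_pos hx6.ne' hx7.ne).ne'
    · exact (ENNReal.toReal_pos hx4 (hx2 ▸ hx5.ne)).ne'
  by_cases hint : Integrable (llr μ ν') μ
  · have hint2 : Integrable (llr μ ν) μ := (integrable_congr hllr).2 (hLint.add hint)
    rw [klDiv_of_ac_of_integrable hac hint2, klDiv_of_ac_of_integrable hac' hint,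
      integral_congr_ae hllr, integral_add hLint hint]
    have hnn := integral_llr_add_sub_measure_univ_nonneg hac' hint
    rw [← ENNReal.ofReal_add hL0 hnn]
    congr 1
    simp
  · have hint2 : ¬ Integrable (llr μ ν) μ := fun h => hint <| by
      -- The log-likelihood ratios differ by the integrable `L`, so either both relative entropies
      -- are finite or both are infinite.
      rw [integrable_congr hllr] at h
      exact (h.sub hLint).congr (ae_of_all _ fun x => by simp)
    rw [klDiv_of_not_integrable hint, klDiv_of_not_integrable hint2, add_top]

/-- The summands of `relEntropy`. -/
noncomputable def siteEntropy (m q : ℝ≥0) : ℝ := q - m + m * log (m / q)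

lemma siteEntropy_eq_mul_klFun (m : ℝ≥0) {q : ℝ≥0} (hq : 0 < q) :
    siteEntropy m q = q * klFun (m / q) := by
  have : (q : ℝ) ≠ 0 := by exact_mod_cast hq.ne'
  rw [siteEntropy, klFun]
  field_simp
  ring

lemma siteEntropy_nonneg (m : ℝ≥0) {q : ℝ≥0} (hq : 0 < q) : 0 ≤ siteEntropy m q := by
  rw [siteEntropy_eq_mul_klFun m hq]
  exact mul_nonneg q.2 (klFun_nonneg (by positivity))

lemma relEntropy_eq_tsum (m q : ℕ+ → ℝ≥0) :
    relEntropy m q = ∑' k, ENNReal.ofReal (siteEntropy (m k) (q k)) := rfl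

lemma poissonMeasure_singleton_eq_mul {m q : ℝ≥0} (hq : 0 < q) (n : ℕ) :
    ProbabilityTheory.poissonMeasure m {n}
      = ENNReal.ofReal (exp (q - m) * (m / q) ^ n) * ProbabilityTheory.poissonMeasure q {n} := by
  rw [ProbabilityTheory.poissonMeasure_singleton, ProbabilityTheory.poissonMeasure_singleton,
    ← ENNReal.ofReal_mul (by positivity)]
  congr 1
  have h1 : (q : ℝ) ≠ 0 := by exact_mod_cast hq.ne'
  rw [sub_eq_add_neg, exp_add, exp_neg (q : ℝ), div_pow]
  field_simp

section Finite

variable {F : Type*} [Fintype F]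

lemma pi_poissonMeasure_eq_withDensity (m : F → ℝ≥0) {q : F → ℝ≥0} (hq : ∀ p, 0 < q p) :
    Measure.pi (fun p => ProbabilityTheory.poissonMeasure (m p))
      = (Measure.pi fun p => ProbabilityTheory.poissonMeasure (q p)).withDensity fun η =>
        ∏ p, ENNReal.ofReal (exp (q p - m p) * (m p / q p) ^ η p) := by
  refine Measure.ext_of_singleton fun η => ?_
  rw [withDensity_apply _ (measurableSet_singleton η), Measure.restrict_singleton,
    lintegral_smul_measure, lintegral_dirac, smul_eq_mul, Measure.pi_singleton,
    Measure.pi_singleton, mul_comm, ← Finset.prod_mul_distrib]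
  exact Finset.prod_congr rfl fun p _ => poissonMeasure_singleton_eq_mul (hq p) (η p)

/-- The log-density between the two Poisson products is affine in `η`, so its `μ`-mean is fixed by
the first moments `m p`, and equals the sum of the `siteEntropy` terms. -/
lemma klDiv_pi_poissonMeasure {μ : Measure (F → ℕ)} [IsProbabilityMeasure μ] {m q : F → ℝ≥0}
    (hq : ∀ p, 0 < q p) (hm : ∀ p, ∫⁻ η, (η p : ℝ≥0∞) ∂μ = m p) :
    klDiv μ (Measure.pi fun p => ProbabilityTheory.poissonMeasure (q p))
      = ∑ p, ENNReal.ofReal (siteEntropy (m p) (q p))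
        + klDiv μ (Measure.pi fun p => ProbabilityTheory.poissonMeasure (m p)) := by
  have hmint : ∀ p, Integrable (fun η : F → ℕ => (η p : ℝ)) μ := fun p => by
    refine ⟨Measurable.of_discrete.aestronglyMeasurable, ?_⟩
    rw [hasFiniteIntegral_iff_enorm]
    simp [hm p]
  have hmean : ∀ p, ∫ η, (η p : ℝ) ∂μ = m p := fun p => by
    rw [integral_eq_lintegral_of_nonneg_ae (ae_of_all _ fun η => by positivity)
      Measurable.of_discrete.aestronglyMeasurable]
    simp [hm p]
  -- Where `m p = 0` the density vanishes unless `η p = 0`; but then `η p = 0` almost surely, so the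
  -- density is positive and its logarithm meaningful.
  have hzero : ∀ᵐ η ∂μ, ∀ p, m p = 0 → η p = 0 := by
    refine ae_all_iff.2 fun p => ?_
    by_cases hp : m p = 0
    · have h1 := hm p
      rw [hp, ENNReal.coe_zero, lintegral_eq_zero_iff (by fun_prop)] at h1
      filter_upwards [h1] with η hη _
      simpa using hη
    · exact ae_of_all _ fun η h => absurd h hp
  let L : (F → ℕ) → ℝ := fun η => ∑ p, (((q p : ℝ) - m p) + η p * log (m p / q p))
  have hLp : ∀ p, Integrable (fun η : F → ℕ => ((q p : ℝ) - m p) + η p * log (m p / q p)) μ :=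
    fun p => (integrable_const _).add ((hmint p).mul_const _)
  have hLint : Integrable L μ := integrable_finsetSum _ fun p _ => hLp p
  have hLval : ∫ η, L η ∂μ = ∑ p, siteEntropy (m p) (q p) := by
    rw [integral_finsetSum _ fun p _ => hLp p]
    refine Finset.sum_congr rfl fun p _ => ?_
    rw [integral_add (integrable_const _) ((hmint p).mul_const _), integral_mul_const, hmean p]
    simp [siteEntropy]
  have hsite : ∀ p ∈ Finset.univ, 0 ≤ siteEntropy (m p) (q p) := fun p _ =>
    siteEntropy_nonneg (m p) (hq p)
  have hpos : ∀ η : F → ℕ, (∀ p, m p = 0 → η p = 0) → ∀ p, 0 < ((m p : ℝ) / q p) ^ η p := by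
    intro η hη p
    have h2 : (0 : ℝ) < q p := by exact_mod_cast hq p
    by_cases hp : m p = 0
    · simp [hη p hp]
    · have h1 : (0 : ℝ) < m p := by exact_mod_cast pos_iff_ne_zero.2 hp
      positivity
  rw [klDiv_eq_ofReal_integral_add (L := L) (Measurable.of_discrete)
    (pi_poissonMeasure_eq_withDensity m hq) ?_ ?_ hLint (hLval ▸ Finset.sum_nonneg hsite), hLval,
    ENNReal.ofReal_sum_of_nonneg hsite]
  · filter_upwards [hzero] with η hη
    refine Finset.prod_ne_zero_iff.2 fun p _ => ?_
    have := hpos η hη p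
    rw [ne_eq, ENNReal.ofReal_eq_zero, not_le]
    positivity
  · filter_upwards [hzero] with η hη
    rw [ENNReal.toReal_prod, Real.log_prod]
    · refine Finset.sum_congr rfl fun p _ => ?_
      have := hpos η hη p
      rw [ENNReal.toReal_ofReal (by positivity), Real.log_mul (exp_pos _).ne' this.ne',
        Real.log_exp, Real.log_pow]
    · intro p _
      have := hpos η hη p
      rw [ENNReal.toReal_ofReal (by positivity)]
      positivity

end Finite

variable {d : ℕ}

lemma map_coords_poissonProcess (m : ℕ+ → ℝ≥0) (A : Finset (Site d × ℕ+)) :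
    (poissonProcess d m).map (coords (A : Set (Site d × ℕ+)))
      = Measure.pi fun p : ↥(A : Set (Site d × ℕ+)) =>
        ProbabilityTheory.poissonMeasure (m p.1.2) := by
  have h := Measure.infinitePi_map_restrict'
    (μ := fun p : Site d × ℕ+ => ProbabilityTheory.poissonMeasure (m p.2))
    (I := (A : Set (Site d × ℕ+)))
  exact h.trans (Measure.infinitePi_eq_pi _)

lemma lintegral_apply_eq_of_mem_stationary {P : Measure (Config d)} (hP : P ∈ stationary d)
    (p : Site d × ℕ+) : ∫⁻ ω, (ω p : ℝ≥0∞) ∂P = ∫⁻ ω, (ω (0, p.2) : ℝ≥0∞) ∂P := by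
  conv_rhs => rw [← hP.2 p.1]
  rw [lintegral_map (by fun_prop) (measurable_shift _)]
  simp [shift]

lemma blockEntropy_finset_eq_add {P : Measure (Config d)} (hP : P ∈ stationary d)
    {m q : ℕ+ → ℝ≥0} (hq : ∀ k, 0 < q k) (hm : ∀ k, ∫⁻ ω, (ω (0, k) : ℝ≥0∞) ∂P = m k)
    (A : Finset (Site d × ℕ+)) :
    blockEntropy q P A = ∑ p ∈ A, ENNReal.ofReal (siteEntropy (m p.2) (q p.2))
      + blockEntropy m P A := by
  have := hP.1
  have := Measure.isProbabilityMeasure_map (μ := P)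
    (measurable_coords (A : Set (Site d × ℕ+))).aemeasurable
  unfold blockEntropy
  rw [map_coords_poissonProcess, map_coords_poissonProcess,
    klDiv_pi_poissonMeasure (m := fun p : ↥(A : Set (Site d × ℕ+)) => m p.1.2)
      (q := fun p => q p.1.2) (fun p => hq p.1.2) ?_]
  · congr 1
    exact Finset.sum_coe_sort A fun p => ENNReal.ofReal (siteEntropy (m p.2) (q p.2))
  · intro p
    rw [lintegral_map (by fun_prop) (measurable_coords _), lintegral_apply_eq_of_mem_stationary hP,
      hm]

/-- The coordinates in `Λ` with marks of size at most `K + 1`. -/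
def truncatedBlock (Λ : Finset (Site d)) (K : ℕ) : Finset (Site d × ℕ+) :=
  Λ ×ˢ Finset.Iic K.succPNat

lemma mem_truncatedBlock {Λ : Finset (Site d)} {K : ℕ} {p : Site d × ℕ+} :
    p ∈ truncatedBlock Λ K ↔ p.1 ∈ Λ ∧ p.2 ≤ K.succPNat := by
  simp [truncatedBlock]

lemma monotone_truncatedBlock (Λ : Finset (Site d)) : Monotone (truncatedBlock Λ) := by
  intro K K' h p hp
  rw [mem_truncatedBlock] at hp ⊢
  exact ⟨hp.1, hp.2.trans (Nat.succPNat_le_succPNat.2 h)⟩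

/-- A site carries infinitely many marks, while the explicit density is available only for finitely
many coordinates. The finite truncations generate the σ-algebra of the block. -/
lemma blockEntropy_le_of_forall_truncatedBlock (m : ℕ+ → ℝ≥0) {P : Measure (Config d)}
    [IsProbabilityMeasure P] (Λ : Finset (Site d)) {C : ℝ≥0∞}
    (hC : ∀ K, blockEntropy m P (truncatedBlock Λ K) ≤ C) :
    blockEntropy m P {p | p.1 ∈ Λ} ≤ C := by
  have := Measure.isProbabilityMeasure_map (μ := P)
    (measurable_coords {p : Site d × ℕ+ | p.1 ∈ Λ}).aemeasurable
  have := Measure.isProbabilityMeasure_map (μ := poissonProcess d m)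
    (measurable_coords {p : Site d × ℕ+ | p.1 ∈ Λ}).aemeasurable
  have hsub : ∀ K, ∀ p ∈ truncatedBlock Λ K, p.1 ∈ Λ := fun K p hp => (mem_truncatedBlock.1 hp).1
  let g : ∀ K, ({p : Site d × ℕ+ | p.1 ∈ Λ} → ℕ) →
      (↥(truncatedBlock Λ K : Set (Site d × ℕ+)) → ℕ) := fun K η a => η ⟨a.1, hsub K a.1 a.2⟩
  have hg : ∀ K, Measurable (g K) := fun K => by unfold g; fun_prop
  refine klDiv_le_of_forall_klDiv_map_le (g := g) hg ?_ ?_ fun K => ?_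
  · intro K K' h
    refine measurable_iff_comap_le.1 ?_
    refine @measurable_pi_lambda _ _ _ (_) _ _ fun p => ?_
    have h1 : Measurable[MeasurableSpace.comap (g K') inferInstance] (g K') :=
      comap_measurable _
    exact (measurable_pi_apply
      (⟨p.1, monotone_truncatedBlock Λ h p.2⟩ : ↥(truncatedBlock Λ K' : Set (Site d × ℕ+)))).comp h1
  · refine iSup_le fun p => ?_
    have hp : p.1 ∈ truncatedBlock Λ (p.1.2 : ℕ) :=
      mem_truncatedBlock.2 ⟨p.2, by
        rw [← PNat.coe_le_coe, Nat.succPNat_coe]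
        exact Nat.le_succ _⟩
    refine le_iSup_of_le (p.1.2 : ℕ) ?_
    refine measurable_iff_comap_le.1 ?_
    have h1 : Measurable[MeasurableSpace.comap (g p.1.2) inferInstance] (g p.1.2) :=
      comap_measurable _
    exact (measurable_pi_apply (⟨p.1, hp⟩ : ↥(truncatedBlock Λ (p.1.2 : ℕ) : Set (Site d × ℕ+)))).comp h1
  · rw [Measure.map_map (hg K) (measurable_coords _), Measure.map_map (hg K) (measurable_coords _)]
    exact hC K

lemma tendsto_blockEntropy_truncatedBlock (m : ℕ+ → ℝ≥0) {P : Measure (Config d)}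
    [IsProbabilityMeasure P] (Λ : Finset (Site d)) :
    Tendsto (fun K => blockEntropy m P (truncatedBlock Λ K)) atTop
      (𝓝 (blockEntropy m P {p | p.1 ∈ Λ})) := by
  have h : blockEntropy m P {p | p.1 ∈ Λ} = ⨆ K, blockEntropy m P (truncatedBlock Λ K) :=
    le_antisymm (blockEntropy_le_of_forall_truncatedBlock m Λ fun K =>
      le_iSup (fun K => blockEntropy m P (truncatedBlock Λ K)) K)
      (iSup_le fun K => blockEntropy_mono m fun p hp => (mem_truncatedBlock.1 hp).1)
  rw [h]
  exact tendsto_atTop_iSup fun K K' hK => blockEntropy_mono m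
    (Finset.coe_subset.2 (monotone_truncatedBlock Λ hK))

lemma tendsto_Iic_succPNat : Tendsto (fun K : ℕ => Finset.Iic K.succPNat) atTop atTop := by
  refine tendsto_atTop_finset_of_monotone
    (fun K K' h => Finset.Iic_subset_Iic.2 (Nat.succPNat_le_succPNat.2 h)) fun k => ⟨k, ?_⟩
  rw [Finset.mem_Iic, ← PNat.coe_le_coe, Nat.succPNat_coe]
  exact Nat.le_succ _

lemma blockEntropy_eq_add {P : Measure (Config d)} (hP : P ∈ stationary d)
    {m q : ℕ+ → ℝ≥0} (hq : ∀ k, 0 < q k) (hm : ∀ k, ∫⁻ ω, (ω (0, k) : ℝ≥0∞) ∂P = m k)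
    (Λ : Finset (Site d)) :
    blockEntropy q P {p | p.1 ∈ Λ} = Λ.card * relEntropy m q + blockEntropy m P {p | p.1 ∈ Λ} := by
  have := hP.1
  refine tendsto_nhds_unique (tendsto_blockEntropy_truncatedBlock q Λ) ?_
  simp only [blockEntropy_finset_eq_add hP hq hm]
  refine Tendsto.add ?_ (tendsto_blockEntropy_truncatedBlock m Λ)
  have h1 : ∀ K, ∑ p ∈ truncatedBlock Λ K, ENNReal.ofReal (siteEntropy (m p.2) (q p.2))
      = Λ.card * ∑ k ∈ Finset.Iic K.succPNat, ENNReal.ofReal (siteEntropy (m k) (q k)) :=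
    fun K => by
      rw [truncatedBlock, Finset.sum_product]
      simp
  simp only [h1]
  refine ENNReal.Tendsto.const_mul ?_ (Or.inr (ENNReal.natCast_ne_top _))
  exact ENNReal.summable.hasSum.comp tendsto_Iic_succPNat

lemma boxEntropy_eq_add {P : Measure (Config d)} (hP : P ∈ stationary d)
    {m q : ℕ+ → ℝ≥0} (hq : ∀ k, 0 < q k) (hm : ∀ k, ∫⁻ ω, (ω (0, k) : ℝ≥0∞) ∂P = m k) (n : ℕ) :
    boxEntropy q P n = relEntropy m q + boxEntropy m P n := by
  rw [boxEntropy_eq, boxEntropy_eq, blockEntropy_eq_add hP hq hm, ENNReal.add_div, mul_comm,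
    ENNReal.mul_div_cancel_right]
  · rw [card_box]
    simp
  · exact ENNReal.natCast_ne_top _

lemma entropyDensity_eq_add {P : Measure (Config d)} (hP : P ∈ stationary d)
    {m q : ℕ+ → ℝ≥0} (hq : ∀ k, 0 < q k) (hm : ∀ k, ∫⁻ ω, (ω (0, k) : ℝ≥0∞) ∂P = m k) :
    entropyDensity q P = relEntropy m q + entropyDensity m P := by
  refine tendsto_nhds_unique (tendsto_boxEntropy q hP) ?_
  have h : boxEntropy q P = fun n => relEntropy m q + boxEntropy m P n :=
    funext fun n => boxEntropy_eq_add hP hq hm n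
  rw [h]
  exact tendsto_const_nhds.add (tendsto_boxEntropy m hP)

lemma relEntropy_le_entropyDensity {P : Measure (Config d)} (hP : P ∈ stationary d)
    {m q : ℕ+ → ℝ≥0} (hq : ∀ k, 0 < q k) (hm : ∀ k, ∫⁻ ω, (ω (0, k) : ℝ≥0∞) ∂P = m k) :
    relEntropy m q ≤ entropyDensity q P :=
  (entropyDensity_eq_add hP hq hm).symm ▸ le_self_add

/-- The size-biasing identity that characterizes the Poisson distribution. -/
lemma lintegral_natCast_mul_poissonMeasure (r : ℝ≥0) (f : ℕ → ℝ≥0∞) :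
    ∫⁻ n, n * f n ∂(ProbabilityTheory.poissonMeasure r)
      = r * ∫⁻ n, f (n + 1) ∂(ProbabilityTheory.poissonMeasure r) := by
  rw [lintegral_countable', lintegral_countable']
  simp only [ProbabilityTheory.poissonMeasure_singleton]
  rw [tsum_eq_zero_add' ENNReal.summable, ← ENNReal.tsum_mul_left]
  simp only [Nat.cast_zero, zero_mul, zero_add]
  refine tsum_congr fun n => ?_
  have h : ((n + 1 : ℕ) : ℝ≥0∞) * ENNReal.ofReal (exp (-r) * r ^ (n + 1) / (n + 1).factorial)
      = r * ENNReal.ofReal (exp (-r) * r ^ n / n.factorial) := by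
    rw [← ENNReal.ofReal_natCast, ← ENNReal.ofReal_mul (by positivity), ← ENNReal.ofReal_coe_nnreal,
      ← ENNReal.ofReal_mul (by positivity), Nat.factorial_succ]
    congr 1
    push_cast
    field_simp
    ring
  rw [mul_right_comm, h]
  ring

lemma lintegral_natCast_poissonMeasure (r : ℝ≥0) :
    ∫⁻ n, (n : ℝ≥0∞) ∂(ProbabilityTheory.poissonMeasure r) = r := by
  simpa using lintegral_natCast_mul_poissonMeasure r 1

lemma lintegral_natCast_mul_self_poissonMeasure (r : ℝ≥0) :
    ∫⁻ n, (n : ℝ≥0∞) * n ∂(ProbabilityTheory.poissonMeasure r) = r * r + r := by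
  have h := lintegral_natCast_mul_poissonMeasure r fun n => n
  simp only [Nat.cast_add, Nat.cast_one] at h
  rw [lintegral_add_right _ measurable_const, lintegral_natCast_poissonMeasure] at h
  simpa [mul_add] using h

lemma map_apply_poissonProcess (m : ℕ+ → ℝ≥0) (p : Site d × ℕ+) :
    (poissonProcess d m).map (fun ω => ω p) = ProbabilityTheory.poissonMeasure (m p.2) :=
  Measure.infinitePi_map_eval (fun p : Site d × ℕ+ => ProbabilityTheory.poissonMeasure (m p.2)) p

lemma lintegral_poissonProcess (m : ℕ+ → ℝ≥0) (p : Site d × ℕ+) :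
    ∫⁻ ω, (ω p : ℝ≥0∞) ∂(poissonProcess d m) = m p.2 := by
  rw [← lintegral_natCast_poissonMeasure (m p.2), ← map_apply_poissonProcess m p,
    lintegral_map (by fun_prop) (measurable_pi_apply p)]

lemma entropyDensity_poissonProcess {q : ℕ+ → ℝ≥0} (hq : ∀ k, 0 < q k) (m : ℕ+ → ℝ≥0) :
    entropyDensity q (poissonProcess d m) = relEntropy m q := by
  rw [entropyDensity_eq_add (poissonProcess_mem_stationary m) hq fun k =>
    lintegral_poissonProcess m (0, k), entropyDensity_poissonProcess_self, add_zero]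

end BoxBoseGas

/-! ### Mixtures of laws; convexity and monotonicity of `φ` and `χ`. -/

namespace BoxBoseGas

open InformationTheory

variable {d : ℕ} {G : ℕ+ → Finset (Site d)} {v : Site d → ℝ≥0} {q : ℕ+ → ℝ≥0}

/-- The cost of a stationary law in the presence of `a` macroscopic particles per site. -/
noncomputable def cost (G : ℕ+ → Finset (Site d)) (v : Site d → ℝ≥0) (q : ℕ+ → ℝ≥0) (a : ℕ)
    (P : Measure (Config d)) : ℝ≥0∞ :=
  entropyDensity q P + ∫⁻ ω, energyAtOrigin G v ω ∂P
    + 2 * (vbar v : ℝ≥0∞) * (a : ℝ≥0∞) * ∫⁻ ω, particlesAtOrigin ω ∂P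
    + (vbar v : ℝ≥0∞) * (a : ℝ≥0∞) ^ 2

lemma cost_mono {a b : ℕ} (h : a ≤ b) (P : Measure (Config d)) :
    cost G v q a P ≤ cost G v q b P := by
  unfold cost
  gcongr

lemma phi_eq_iInf (m : ℕ+ → ℝ≥0) (ψ : ℕ → ℝ≥0) :
    phi G v q m ψ = ⨅ P : admissible d m ψ, ∑' a, (ψ a : ℝ≥0∞) * cost G v q a (P.1 a) :=
  iInf_subtype'

lemma phi_le {m : ℕ+ → ℝ≥0} {ψ : ℕ → ℝ≥0} {P : ℕ → Measure (Config d)}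
    (hP : P ∈ admissible d m ψ) :
    phi G v q m ψ ≤ ∑' a, (ψ a : ℝ≥0∞) * cost G v q a (P a) :=
  iInf₂_le P hP

section Mixture

lemma map_sum_smul {ι X Y : Type*} [MeasurableSpace X] [MeasurableSpace Y] (c : ι → ℝ≥0∞)
    (Q : ι → Measure X) {f : X → Y} (hf : Measurable f) :
    (Measure.sum fun i => c i • Q i).map f = Measure.sum fun i => c i • (Q i).map f := by
  rw [Measure.map_sum hf.aemeasurable]
  simp only [Measure.map_smul]


variable {ι : Type*} {c : ι → ℝ≥0∞} {Q : ι → Measure (Config d)}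

lemma sum_smul_mem_stationary (hc : ∑' i, c i = 1) (hQ : ∀ i, Q i ∈ stationary d) :
    (Measure.sum fun i => c i • Q i) ∈ stationary d := by
  have := fun i => (hQ i).1
  refine ⟨⟨?_⟩, fun z => ?_⟩
  · rw [Measure.sum_apply _ MeasurableSet.univ]
    simp [hc]
  · rw [map_sum_smul c Q (measurable_shift z)]
    simp only [fun i => (hQ i).2 z]

variable [Countable ι]

lemma entropyDensity_sum_smul_le (hc : ∑' i, c i = 1) (hQ : ∀ i, Q i ∈ stationary d) :
    entropyDensity q (Measure.sum fun i => c i • Q i) ≤ ∑' i, c i * entropyDensity q (Q i) := by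
  have := fun i => (hQ i).1
  rw [entropyDensity_eq_iSup q (sum_smul_mem_stationary hc hQ)]
  refine iSup_le fun n => ?_
  have h1 : boxEntropy q (Measure.sum fun i => c i • Q i) n ≤ ∑' i, c i * boxEntropy q (Q i) n := by
    simp only [boxEntropy_eq, blockEntropy, map_sum_smul c Q (measurable_coords _), ← mul_div_assoc]
    simp only [div_eq_mul_inv, ENNReal.tsum_mul_right]
    have := fun i => Measure.isProbabilityMeasure_map (μ := Q i)
      (measurable_coords {p : Site d × ℕ+ | p.1 ∈ box d n}).aemeasurable
    have := Measure.isProbabilityMeasure_map (μ := poissonProcess d q)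
      (measurable_coords {p : Site d × ℕ+ | p.1 ∈ box d n}).aemeasurable
    exact mul_le_mul_left (klDiv_sum_smul_le hc) _
  refine h1.trans (ENNReal.tsum_le_tsum fun i => mul_le_mul_right ?_ _)
  rw [entropyDensity_eq_iSup q (hQ i)]
  exact le_iSup (boxEntropy q (Q i)) n

lemma cost_sum_smul_le (hc : ∑' i, c i = 1) (hQ : ∀ i, Q i ∈ stationary d) (a : ℕ) :
    cost G v q a (Measure.sum fun i => c i • Q i) ≤ ∑' i, c i * cost G v q a (Q i) := by
  have h : ∑' i, c i * cost G v q a (Q i)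
      = ∑' i, c i * entropyDensity q (Q i) + ∑' i, c i * ∫⁻ ω, energyAtOrigin G v ω ∂(Q i)
        + 2 * (vbar v : ℝ≥0∞) * (a : ℝ≥0∞) * ∑' i, c i * ∫⁻ ω, particlesAtOrigin ω ∂(Q i)
        + (vbar v : ℝ≥0∞) * (a : ℝ≥0∞) ^ 2 := by
    simp only [cost, mul_add, ENNReal.tsum_add]
    rw [ENNReal.tsum_mul_right, hc, one_mul, ← ENNReal.tsum_mul_left]
    congr 2
    exact tsum_congr fun i => by ring
  rw [h]
  unfold cost
  simp only [lintegral_sum_measure, lintegral_smul_measure, smul_eq_mul]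
  gcongr
  exact entropyDensity_sum_smul_le hc hQ

/-- Normalizes a mixture of total mass `s`. For `s = 0` the law is irrelevant and any `Q i₀` serves.
-/
lemma exists_mem_stationary_smul_eq_sum [Nonempty ι] {s : ℝ≥0∞} (hs : s ≠ ∞)
    (hc : ∑' i, c i = s) (hQ : ∀ i, Q i ∈ stationary d) :
    ∃ P ∈ stationary d, (s • P = Measure.sum fun i => c i • Q i) ∧
      ∀ a, s * cost G v q a P ≤ ∑' i, c i * cost G v q a (Q i) := by
  obtain ⟨i₀⟩ := ‹Nonempty ι›
  by_cases hs0 : s = 0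
  · subst hs0
    rw [ENNReal.tsum_eq_zero] at hc
    refine ⟨Q i₀, hQ i₀, ?_, by simp⟩
    simp [hc]
  have hc' : ∑' i, s⁻¹ * c i = 1 := by
    rw [ENNReal.tsum_mul_left, hc, ENNReal.inv_mul_cancel hs0 hs]
  have hcancel : ∀ i, ∀ x : ℝ≥0∞, s * (s⁻¹ * c i * x) = c i * x := fun i x => by
    rw [← mul_assoc, ← mul_assoc, ENNReal.mul_inv_cancel hs0 hs, one_mul]
  refine ⟨_, sum_smul_mem_stationary hc' hQ, ?_, fun a => ?_⟩
  · ext t ht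
    simp only [Measure.smul_apply, Measure.sum_apply _ ht, smul_eq_mul]
    rw [← ENNReal.tsum_mul_left]
    exact tsum_congr fun i => hcancel i _
  · refine (mul_le_mul_right (cost_sum_smul_le hc' hQ a) s).trans_eq ?_
    rw [← ENNReal.tsum_mul_left]
    exact tsum_congr fun i => hcancel i _

/-- Bound on `phi` by redistributing the stationary laws `Q i`, placed at `b i`, to lower levels
with the weights `w`. -/
lemma phi_le_of_weights [Nonempty ι] {m : ℕ+ → ℝ≥0} {ψ : ℕ → ℝ≥0} {w : ℕ → ι → ℝ≥0∞} {b : ι → ℕ}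
    (hQ : ∀ i, Q i ∈ stationary d) (hw : ∀ a, ∑' i, w a i = ψ a)
    (hm : ∀ k, ∑' i, (∑' a, w a i) * ∫⁻ ω, (ω (0, k) : ℝ≥0∞) ∂(Q i) = m k)
    (hb : ∀ a i, w a i ≠ 0 → a ≤ b i) :
    phi G v q m ψ ≤ ∑' i, (∑' a, w a i) * cost G v q (b i) (Q i) := by
  -- The new law at level `a` is the mixture of the `Q i` with weights `w a i / ψ a`. Intensities
  -- are preserved, and the cost does not grow because it is monotone in the level.
  choose P hP hPeq hPcost using fun a => exists_mem_stationary_smul_eq_sum (G := G) (v := v)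
    (q := q) ENNReal.coe_ne_top (hw a) hQ
  refine (phi_le (P := P) ⟨hP, fun k => ?_⟩).trans ?_
  · rw [← hm k]
    calc ∑' a, (ψ a : ℝ≥0∞) * ∫⁻ ω, (ω (0, k) : ℝ≥0∞) ∂(P a)
        = ∑' a, ∑' i, w a i * ∫⁻ ω, (ω (0, k) : ℝ≥0∞) ∂(Q i) := tsum_congr fun a => by
          rw [← smul_eq_mul, ← lintegral_smul_measure, hPeq a, lintegral_sum_measure]
          simp only [lintegral_smul_measure, smul_eq_mul]
      _ = _ := by
          rw [ENNReal.tsum_comm]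
          simp only [ENNReal.tsum_mul_right]
  · calc ∑' a, (ψ a : ℝ≥0∞) * cost G v q a (P a)
        ≤ ∑' a, ∑' i, w a i * cost G v q (b i) (Q i) := ENNReal.tsum_le_tsum fun a =>
          (hPcost a a).trans (ENNReal.tsum_le_tsum fun i => by
            by_cases h0 : w a i = 0
            · simp [h0]
            · exact mul_le_mul_right (cost_mono (hb a i h0) _) _)
      _ = _ := by
          rw [ENNReal.tsum_comm]
          simp only [ENNReal.tsum_mul_right]

end Mixture

section Convexity

/-- Nonzero coefficients matter: over an empty index type the hypothesis is void, whereas `0 * ∞ =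
0`. -/
lemma le_mul_iInf_add_mul_iInf {ι κ : Sort*} {f : ι → ℝ≥0∞} {g : κ → ℝ≥0∞} {a b : ℝ≥0}
    (ha : a ≠ 0) (hb : b ≠ 0) {z : ℝ≥0∞} (h : ∀ i j, z ≤ a * f i + b * g j) :
    z ≤ a * (⨅ i, f i) + b * ⨅ j, g j := by
  rw [ENNReal.mul_iInf_of_ne (by simpa) ENNReal.coe_ne_top,
    ENNReal.mul_iInf_of_ne (by simpa) ENNReal.coe_ne_top]
  exact ENNReal.le_iInf_add_iInf h

lemma convex_probs : Convex ℝ≥0 probs := by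
  intro ψ hψ ψ' hψ' a b _ _ hab
  have := (HasSum.mul_left a hψ).add (HasSum.mul_left b hψ')
  rwa [mul_one, mul_one, hab] at this

lemma phi_add_le {m m' : ℕ+ → ℝ≥0} {ψ ψ' : ℕ → ℝ≥0} {a b : ℝ≥0} (ha : a ≠ 0) (hb : b ≠ 0) :
    phi G v q (a • m + b • m') (a • ψ + b • ψ')
      ≤ a * phi G v q m ψ + b * phi G v q m' ψ' := by
  rw [phi_eq_iInf m ψ, phi_eq_iInf m' ψ']
  refine le_mul_iInf_add_mul_iInf ha hb fun ⟨P, hP, hPm⟩ ⟨P', hP', hPm'⟩ => ?_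
  -- The index `(true, n)` stands for `P n` and `(false, n)` for `P' n`. Mass stays at its own level
  -- `n`; only the two laws there are mixed.
  let w : ℕ → Bool × ℕ → ℝ≥0∞ := fun n i =>
    if n = i.2 then (bif i.1 then (a * ψ n : ℝ≥0∞) else (b * ψ' n : ℝ≥0∞)) else 0
  have hw : ∀ i : Bool × ℕ, ∑' n, w n i = bif i.1 then (a * ψ i.2 : ℝ≥0∞) else (b * ψ' i.2) :=
    fun i => by simp [w, tsum_ite_eq]
  refine (phi_le_of_weights (w := w) (b := Prod.snd)
    (Q := fun i : Bool × ℕ => bif i.1 then P i.2 else P' i.2) ?_ ?_ ?_ ?_).trans_eq ?_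
  · rintro ⟨_ | _, n⟩
    · exact hP' n
    · exact hP n
  · intro n
    rw [ENNReal.tsum_prod', tsum_bool]
    have h1 : ∀ x : ℝ≥0∞, ∑' i : ℕ, (if n = i then x else 0) = x := fun x => by
      simp_rw [eq_comm (a := n)]
      exact tsum_ite_eq n fun _ => x
    simp only [w, cond_false, cond_true, h1]
    simp [add_comm]
  · intro k
    simp only [hw]
    rw [ENNReal.tsum_prod', tsum_bool]
    simp only [cond_false, cond_true, mul_assoc, ENNReal.tsum_mul_left, hPm k, hPm' k]
    simp [add_comm]
  · intro n i h
    by_contra hne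
    exact h (if_neg fun h' => hne h'.le)
  · simp only [hw]
    rw [ENNReal.tsum_prod', tsum_bool]
    simp only [cond_false, cond_true, mul_assoc, ENNReal.tsum_mul_left]
    rw [add_comm]

lemma convexOn_phi : ConvexOn ℝ≥0 {p : (ℕ+ → ℝ≥0) × (ℕ → ℝ≥0) | p.2 ∈ probs}
    (fun p => phi G v q p.1 p.2) := by
  refine ⟨fun p hp p' hp' a b ha hb hab => convex_probs hp hp' ha hb hab,
    fun p _ p' _ a b _ _ hab => ?_⟩
  by_cases ha : a = 0
  · subst ha
    obtain rfl : b = 1 := by simpa using hab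
    simp
  by_cases hb : b = 0
  · subst hb
    obtain rfl : a = 1 := by simpa using hab
    simp
  exact phi_add_le ha hb

end Convexity

section StochasticOrder

lemma sum_range_add_tsum_Ici {ψ : ℕ → ℝ≥0} (hψ : ψ ∈ probs) (a : ℕ) :
    ∑ i ∈ Finset.range a, ψ i + ∑' b : Set.Ici a, ψ b = 1 := by
  have h1 := NNReal.sum_add_tsum_nat_add a (f := ψ) hψ.summable
  rw [hψ.tsum_eq] at h1
  rw [h1]
  congr 1
  let e : ℕ ≃ Set.Ici a :=
    { toFun := fun i => ⟨i + a, Nat.le_add_left a i⟩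
      invFun := fun b => b.1 - a
      left_inv := fun i => by simp
      right_inv := fun b => Subtype.ext (Nat.sub_add_cancel b.2) }
  exact (e.tsum_eq fun b : Set.Ici a => ψ b).symm

/-- The quantile coupling. -/
lemma StochLE.exists_coupling {ψ ψ' : ℕ → ℝ≥0} (hψ : ψ ∈ probs) (hψ' : ψ' ∈ probs)
    (h : StochLE ψ ψ') : ∃ c : ℕ → ℕ → ℝ≥0∞, (∀ a, ∑' b, c a b = ψ a) ∧
      (∀ b, ∑' a, c a b = ψ' b) ∧ ∀ a b, c a b ≠ 0 → a ≤ b := by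
  -- `F ψ a` is the mass of `[0, a)`. The intervals `[F ψ a, F ψ (a + 1))` and those of `ψ'` both
  -- partition `[0, 1)`, and the coupling weights are the lengths of their overlaps.
  let F : (ℕ → ℝ≥0) → ℕ → ℝ := fun ψ a => (∑ i ∈ Finset.range a, ψ i : ℝ≥0)
  have hmono : ∀ ψ, Monotone (F ψ) := fun ψ => monotone_nat_of_le_succ fun n => by
    simp only [F, Finset.sum_range_succ, NNReal.coe_add]
    exact le_add_of_nonneg_right (ψ n).2
  let I : (ℕ → ℝ≥0) → ℕ → Set ℝ := fun ψ a => Set.Ico (F ψ a) (F ψ (a + 1))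
  have hdisj : ∀ ψ, Pairwise (Function.onFun Disjoint (I ψ)) := fun ψ =>
    (hmono ψ).pairwise_disjoint_on_Ico_succ
  have hvol : ∀ ψ a, volume (I ψ a) = ψ a := fun ψ a => by
    simp [I, F, Finset.sum_range_succ]
  have hlt : ∀ ψ ∈ probs, ∀ a, F ψ a ≤ 1 := fun ψ hψ a => by
    have := sum_range_add_tsum_Ici hψ a
    exact_mod_cast (le_self_add.trans this.le)
  have hcover : ∀ ψ ∈ probs, ∀ ψ' ∈ probs, ∀ a, I ψ a ⊆ ⋃ b, I ψ' b := by
    intro ψ hψ ψ' hψ' a x hx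
    have h0 : 0 ≤ x := le_trans (NNReal.coe_nonneg _) hx.1
    have h1 : x < 1 := hx.2.trans_le (hlt ψ hψ _)
    have hlim : Tendsto (F ψ') atTop (𝓝 1) := by
      have := (NNReal.continuous_coe.tendsto _).comp hψ'.tendsto_sum_nat
      rwa [NNReal.coe_one] at this
    have hex : ∃ n, x < F ψ' n := (hlim.eventually (eventually_gt_nhds h1)).exists
    classical
    have hn0 : Nat.find hex ≠ 0 := fun h => by
      have := Nat.find_spec hex
      rw [h] at this
      simp [F] at this
      linarith
    obtain ⟨n, hn⟩ := Nat.exists_eq_succ_of_ne_zero hn0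
    refine Set.mem_iUnion.2 ⟨n, ?_, ?_⟩
    · exact not_lt.1 (Nat.find_min hex (by omega))
    · have := Nat.find_spec hex
      rwa [hn] at this
  have hsum : ∀ ψ ∈ probs, ∀ ψ' ∈ probs, ∀ a, ∑' b, volume (I ψ a ∩ I ψ' b) = ψ a := by
    intro ψ hψ ψ' hψ' a
    rw [← measure_iUnion, ← Set.inter_iUnion, Set.inter_eq_left.2 (hcover ψ hψ ψ' hψ' a), hvol]
    · exact fun i j hij => (hdisj ψ' hij).mono Set.inter_subset_right Set.inter_subset_right
    · exact fun b => measurableSet_Ico.inter measurableSet_Ico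
  refine ⟨fun a b => volume (I ψ a ∩ I ψ' b), hsum ψ hψ ψ' hψ', fun b => ?_, fun a b hab => ?_⟩
  · simp only [Set.inter_comm (I ψ _)]
    exact hsum ψ' hψ' ψ hψ b
  · by_contra! hlt'
    obtain ⟨x, hx, hx'⟩ := nonempty_of_measure_ne_zero hab
    -- Larger tails mean a smaller distribution function. For `b < a` the `ψ'`-interval of `b` would
    -- end before the `ψ`-interval of `a` begins.
    have h1 : F ψ' a ≤ F ψ a := by
      have e1 := sum_range_add_tsum_Ici hψ a
      have e2 := sum_range_add_tsum_Ici hψ' a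
      have e3 := h a
      refine NNReal.coe_le_coe.2 ?_
      by_contra! h4
      exact absurd (e1.trans e2.symm) (add_lt_add_of_lt_of_le h4 e3).ne
    have h2 : F ψ' (b + 1) ≤ F ψ' a := hmono ψ' hlt'
    linarith [hx.1, hx'.2]

/-- Along the coupling, each law placed at level `b` is moved to levels `a ≤ b`. Its total weight is
unchanged, hence so are the intensities. -/
lemma phi_mono_stochLE (m : ℕ+ → ℝ≥0) {ψ ψ' : ℕ → ℝ≥0} (hψ : ψ ∈ probs) (hψ' : ψ' ∈ probs)
    (h : StochLE ψ ψ') : phi G v q m ψ ≤ phi G v q m ψ' := by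
  obtain ⟨c, hc1, hc2, hc3⟩ := h.exists_coupling hψ hψ'
  refine le_iInf₂ fun P hP => ?_
  refine (phi_le_of_weights (w := c) (b := id) hP.1 hc1 (fun k => ?_) hc3).trans_eq ?_
  · simp only [hc2]
    exact hP.2 k
  · simp only [hc2]
    rfl

end StochasticOrder

section Chi

/-- The constraint set of `chi`. -/
def feasible (ρmi ρma : ℝ≥0) : Set ((ℕ+ → ℝ≥0) × (ℕ → ℝ≥0)) :=
  {x | HasSum (fun k : ℕ+ => ((k : ℕ) : ℝ≥0) * x.1 k) ρmi ∧ x.2 ∈ probs ∧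
    HasSum (fun a : ℕ => (a : ℝ≥0) * x.2 a) ρma}

lemma chi_eq_iInf (ρmi ρma : ℝ≥0) :
    chi G v q ρmi ρma = ⨅ x : feasible ρmi ρma, phi G v q x.1.1 x.1.2 := by
  refine le_antisymm (le_iInf fun ⟨⟨m, ψ⟩, h1, h2, h3⟩ => ?_) ?_
  · exact iInf_le_of_le m <| iInf_le_of_le h1 <| iInf_le_of_le ψ <| iInf_le_of_le h2 <|
      iInf_le_of_le h3 le_rfl
  · exact le_iInf fun m => le_iInf fun h1 => le_iInf fun ψ => le_iInf fun h2 => le_iInf fun h3 =>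
      iInf_le (fun x : feasible ρmi ρma => phi G v q x.1.1 x.1.2) ⟨(m, ψ), h1, h2, h3⟩

lemma chi_le {ρmi ρma : ℝ≥0} {m : ℕ+ → ℝ≥0} {ψ : ℕ → ℝ≥0} (h : (m, ψ) ∈ feasible ρmi ρma) :
    chi G v q ρmi ρma ≤ phi G v q m ψ :=
  chi_eq_iInf (G := G) (v := v) (q := q) ρmi ρma ▸
    iInf_le (fun x : feasible ρmi ρma => phi G v q x.1.1 x.1.2) ⟨_, h⟩

lemma le_chi {ρmi ρma : ℝ≥0} {z : ℝ≥0∞}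
    (h : ∀ m ψ, (m, ψ) ∈ feasible ρmi ρma → z ≤ phi G v q m ψ) : z ≤ chi G v q ρmi ρma :=
  chi_eq_iInf (G := G) (v := v) (q := q) ρmi ρma ▸ le_iInf fun x => h _ _ x.2

lemma convexOn_chi :
    ConvexOn ℝ≥0 Set.univ (fun ρ : ℝ≥0 × ℝ≥0 => chi G v q ρ.1 ρ.2) := by
  refine ⟨convex_univ, fun ρ _ ρ' _ a b ha' hb' hab => ?_⟩
  by_cases ha : a = 0
  · subst ha
    obtain rfl : b = 1 := by simpa using hab
    simp
  by_cases hb : b = 0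
  · subst hb
    obtain rfl : a = 1 := by simpa using hab
    simp
  change chi G v q (a * ρ.1 + b * ρ'.1) (a * ρ.2 + b * ρ'.2)
    ≤ (a : ℝ≥0∞) * chi G v q ρ.1 ρ.2 + (b : ℝ≥0∞) * chi G v q ρ'.1 ρ'.2
  rw [chi_eq_iInf ρ.1 ρ.2, chi_eq_iInf ρ'.1 ρ'.2]
  refine le_mul_iInf_add_mul_iInf ha hb fun ⟨⟨m, ψ⟩, h1, h2, h3⟩ ⟨⟨m', ψ'⟩, h1', h2', h3'⟩ => ?_
  refine (chi_le (m := a • m + b • m') (ψ := a • ψ + b • ψ') ⟨?_, ?_, ?_⟩).trans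
    (phi_add_le ha hb)
  · convert! (HasSum.mul_left a h1).add (HasSum.mul_left b h1') using 2
    simp
    ring
  · exact convex_probs h2 h2' ha' hb' hab
  · convert! (HasSum.mul_left a h3).add (HasSum.mul_left b h3') using 2
    simp
    ring

lemma convexOn_chi_zero : ConvexOn ℝ≥0 Set.univ (fun ρ : ℝ≥0 => chi G v q ρ 0) := by
  refine ⟨convex_univ, fun ρ _ ρ' _ a b ha hb hab => ?_⟩
  have := (convexOn_chi (G := G) (v := v) (q := q)).2 (Set.mem_univ (ρ, 0)) (Set.mem_univ (ρ', 0))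
    ha hb hab
  simpa using this

/-- The point mass at `0`, as a weight function. -/
noncomputable def deltaZero : ℕ → ℝ≥0 := Pi.single 0 1

lemma deltaZero_mem_probs : deltaZero ∈ probs := hasSum_pi_single 0 1

lemma monotone_chi (ρmi : ℝ≥0) : Monotone (fun ρma : ℝ≥0 => chi G v q ρmi ρma) := by
  intro ρ ρ' hρ
  rcases eq_or_ne ρ' 0 with rfl | hρ'
  · obtain rfl : ρ = 0 := by simpa using hρ
    exact le_rfl
  refine le_chi fun m ψ ⟨h1, h2, h3⟩ => ?_
  have ht1 : ρ / ρ' ≤ 1 := div_le_one_of_le₀ hρ (zero_le)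
  -- Keeping `ψ` with probability `ρ / ρ'` and using `0` otherwise scales the mean to `ρ` and lowers
  -- the law stochastically.
  let ψ₁ : ℕ → ℝ≥0 := (ρ / ρ') • ψ + (1 - ρ / ρ') • deltaZero
  have hψ₁ : ψ₁ ∈ probs := convex_probs h2 deltaZero_mem_probs zero_le zero_le
    (add_tsub_cancel_of_le ht1)
  have hmean : HasSum (fun a : ℕ => (a : ℝ≥0) * ψ₁ a) ρ := by
    convert! HasSum.mul_left (ρ / ρ') h3 using 1
    · funext a
      rcases eq_or_ne a 0 with rfl | ha
      · simp
      · simp [ψ₁, deltaZero, ha]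
        ring
    · exact (div_mul_cancel₀ ρ hρ').symm
  refine (chi_le (m := m) (ψ := ψ₁) ⟨h1, hψ₁, hmean⟩).trans (phi_mono_stochLE m hψ₁ h2 fun a => ?_)
  rcases eq_or_ne a 0 with rfl | ha
  · have e1 := sum_range_add_tsum_Ici hψ₁ 0
    have e2 := sum_range_add_tsum_Ici h2 0
    simp only [Finset.range_zero, Finset.sum_empty, zero_add] at e1 e2
    rw [e1, e2]
  · have hle : ∀ b : Set.Ici a, ψ₁ b ≤ ψ b := fun b => by
      have hb : (b : ℕ) ≠ 0 := fun h => ha (Nat.le_zero.1 (h ▸ b.2))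
      simp only [ψ₁, deltaZero, Pi.add_apply, Pi.smul_apply, smul_eq_mul, Pi.single_apply, hb,
        if_false, mul_zero, add_zero]
      exact mul_le_of_le_one_left zero_le ht1
    exact Summable.tsum_le_tsum hle (NNReal.summable_comp_injective hψ₁.summable
      Subtype.val_injective) (NNReal.summable_comp_injective h2.summable Subtype.val_injective)

end Chi

end BoxBoseGas

/-! ### Upper and lower bounds on the mean energy. -/

namespace BoxBoseGas

variable {d : ℕ}

section Kernel

variable {v : Site d → ℝ≥0}

lemma tsum_coe_eq_vbar (hv : (Function.support v).Finite) : ∑' z, (v z : ℝ≥0∞) = vbar v :=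
  (ENNReal.coe_tsum (summable_of_hasFiniteSupport hv)).symm

lemma tsum_pairEnergy (hv : (Function.support v).Finite) (A B : Finset (Site d)) :
    ∑' y, (pairEnergy v 0 y A B : ℝ≥0∞) = A.card * B.card * vbar v := by
  have h : ∀ i j : Site d, ∑' y, (v (0 + i - y - j) : ℝ≥0∞) = vbar v := fun i j => by
    rw [← tsum_coe_eq_vbar hv, ← (Equiv.subLeft (i - j)).tsum_eq fun z => (v z : ℝ≥0∞)]
    refine tsum_congr fun y => ?_
    rw [Equiv.subLeft_apply]
    congr 2
    abel
  simp only [pairEnergy, ENNReal.ofNNReal_finsetSum]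
  rw [Summable.tsum_finsetSum fun _ _ => ENNReal.summable]
  simp only [Summable.tsum_finsetSum fun _ _ => ENNReal.summable, h]
  simp [mul_assoc]

/-- For fixed `i` the differences `i - j` are distinct, so the inner sum is at most `v̄`. -/
lemma pairEnergy_self_le (hv : (Function.support v).Finite) (A : Finset (Site d)) :
    (pairEnergy v 0 0 A A : ℝ≥0∞) ≤ A.card * vbar v := by
  simp only [pairEnergy, ENNReal.ofNNReal_finsetSum]
  have h : ∀ i ∈ A, ∑ j ∈ A, (v (0 + i - 0 - j) : ℝ≥0∞) ≤ vbar v := fun i _ => by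
    refine (ENNReal.sum_le_tsum A).trans_eq ?_
    rw [← tsum_coe_eq_vbar hv, ← (Equiv.subLeft i).tsum_eq fun z => (v z : ℝ≥0∞)]
    simp
  refine (Finset.sum_le_sum h).trans_eq ?_
  simp

end Kernel

section Moments

/-- The mixed second moment of the points at `0` with mark `k` and those at `y` with mark `l`. -/
noncomputable def pairMoment (P : Measure (Config d)) (y : Site d) (k l : ℕ+) : ℝ≥0∞ :=
  ∫⁻ ω, (ω (0, k) : ℝ≥0∞) * (ω (y, l) : ℝ≥0∞) ∂P

lemma measurable_natCast_apply (p : Site d × ℕ+) :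
    Measurable fun ω : Config d => (ω p : ℝ≥0∞) := by fun_prop

lemma lintegral_energyAtOrigin (G : ℕ+ → Finset (Site d)) (v : Site d → ℝ≥0)
    (P : Measure (Config d)) :
    ∫⁻ ω, energyAtOrigin G v ω ∂P
      = ∑' (y : Site d) (k : ℕ+) (l : ℕ+),
        pairMoment P y k l * (pairEnergy v 0 y (G k) (G l) : ℝ≥0∞) := by
  unfold energyAtOrigin pairMoment
  have hm : ∀ y k l, Measurable fun ω : Config d =>
      (ω (0, k) : ℝ≥0∞) * (ω (y, l) : ℝ≥0∞) := fun y k l => by fun_prop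
  have hm' : ∀ y k l, Measurable fun ω : Config d =>
      (ω (0, k) : ℝ≥0∞) * (ω (y, l) : ℝ≥0∞) * (pairEnergy v 0 y (G k) (G l) : ℝ≥0∞) :=
    fun y k l => (hm y k l).mul_const _
  have hm2 : ∀ y k, Measurable fun ω : Config d => ∑' l : ℕ+,
      (ω (0, k) : ℝ≥0∞) * (ω (y, l) : ℝ≥0∞) * (pairEnergy v 0 y (G k) (G l) : ℝ≥0∞) :=
    fun y k => Measurable.tsum (hm' y k)
  rw [lintegral_tsum fun y => (Measurable.tsum (hm2 y)).aemeasurable]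
  refine tsum_congr fun y => ?_
  rw [lintegral_tsum fun k => (hm2 y k).aemeasurable]
  refine tsum_congr fun k => ?_
  rw [lintegral_tsum fun l => (hm' y k l).aemeasurable]
  exact tsum_congr fun l => lintegral_mul_const _ (hm y k l)

lemma pairMoment_poissonProcess (m : ℕ+ → ℝ≥0) (y : Site d) (k l : ℕ+) :
    pairMoment (poissonProcess d m) y k l
      = m k * m l + if y = 0 then (if k = l then (m k : ℝ≥0∞) else 0) else 0 := by
  unfold pairMoment
  by_cases h : ((0 : Site d), k) = (y, l)
  · obtain ⟨rfl, rfl⟩ := Prod.mk.inj h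
    simp only [if_true]
    rw [← lintegral_natCast_mul_self_poissonMeasure (m k),
      ← map_apply_poissonProcess m ((0 : Site d), k),
      lintegral_map (by fun_prop) (measurable_pi_apply _)]
  · have h1 : ProbabilityTheory.iIndepFun (fun (p : Site d × ℕ+) (ω : Config d) => ω p)
        (poissonProcess d m) :=
      ProbabilityTheory.iIndepFun_infinitePi (X := fun _ x => x) fun _ => measurable_id
    have h2 := (h1.indepFun h).comp (φ := fun n : ℕ => (n : ℝ≥0∞)) (ψ := fun n : ℕ => (n : ℝ≥0∞))
      Measurable.of_discrete Measurable.of_discrete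
    have h3 := ProbabilityTheory.lintegral_mul_eq_lintegral_mul_lintegral_of_indepFun
      (measurable_natCast_apply _) (measurable_natCast_apply _) h2
    have h4 : (if y = 0 then (if k = l then (m k : ℝ≥0∞) else 0) else 0) = 0 := by
      split_ifs with h5 h6
      · exact absurd (by rw [h5, h6]) h
      · rfl
      · rfl
    rw [h4, add_zero]
    refine h3.trans ?_
    rw [lintegral_poissonProcess, lintegral_poissonProcess]

lemma coe_hasSum {ρ : ℝ≥0} {m : ℕ+ → ℝ≥0} (hρ : HasSum (fun k : ℕ+ => ((k : ℕ) : ℝ≥0) * m k) ρ) :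
    ∑' k : ℕ+, ((k : ℕ) : ℝ≥0∞) * m k = ρ := by
  have := (ENNReal.hasSum_coe.2 hρ).tsum_eq
  simpa using this

/-- The product of the means contributes exactly `v̄ρ²`. The extra Poisson second moment lives on `y
= 0`, `k = l`, and adds at most `v̄ ∑ k m_k = v̄ρ`. -/
lemma lintegral_energyAtOrigin_poissonProcess_le {G : ℕ+ → Finset (Site d)} (hG : IsMarkFamily G)
    {v : Site d → ℝ≥0} (hv : (Function.support v).Finite) {m : ℕ+ → ℝ≥0} {ρ : ℝ≥0}
    (hρ : HasSum (fun k : ℕ+ => ((k : ℕ) : ℝ≥0) * m k) ρ) :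
    ∫⁻ ω, energyAtOrigin G v ω ∂(poissonProcess d m)
      ≤ vbar v * ((ρ : ℝ≥0∞) ^ 2 + ρ) := by
  have hρ' := coe_hasSum hρ
  rw [lintegral_energyAtOrigin]
  simp only [pairMoment_poissonProcess, add_mul, ENNReal.tsum_add]
  rw [mul_add]
  refine add_le_add ?_ ?_
  · rw [ENNReal.tsum_comm]
    have h1 : ∀ k : ℕ+, ∑' (y : Site d) (l : ℕ+),
        (m k : ℝ≥0∞) * m l * (pairEnergy v 0 y (G k) (G l) : ℝ≥0∞)
          = ((k : ℕ) : ℝ≥0∞) * m k * (ρ * vbar v) := fun k => by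
      rw [ENNReal.tsum_comm, ← hρ', ← ENNReal.tsum_mul_right, ← ENNReal.tsum_mul_left]
      refine tsum_congr fun l => ?_
      rw [ENNReal.tsum_mul_left, tsum_pairEnergy hv, (hG k).1, (hG l).1]
      ring
    simp only [h1, ENNReal.tsum_mul_right, hρ']
    exact le_of_eq (by ring)
  · rw [tsum_eq_single 0 fun y hy => by simp [hy]]
    rw [mul_comm, ← hρ', ← ENNReal.tsum_mul_right]
    refine ENNReal.tsum_le_tsum fun k => ?_
    rw [tsum_eq_single k fun l hl => by simp [hl.symm]]
    simp only [if_true]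
    refine (mul_le_mul_right (pairEnergy_self_le hv (G k)) _).trans_eq ?_
    rw [(hG k).1]
    ring

end Moments

section LowerBound

variable (G : ℕ+ → Finset (Site d))

/-- The number of particles at the site `x`. -/
noncomputable def particlesAt (x : Site d) (ω : Config d) : ℝ≥0∞ :=
  ∑' k : ℕ+, ∑ i ∈ G k, (ω (x - i, k) : ℝ≥0∞)

lemma measurable_particlesAt (x : Site d) : Measurable (particlesAt G x) :=
  Measurable.tsum fun _ => Finset.measurable_fun_sum _ fun _ _ =>
    measurable_natCast_apply _

variable {G}

lemma particlesAt_eq_shift (x : Site d) (ω : Config d) :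
    particlesAt G x ω = particlesAt G 0 (shift x ω) := by
  simp only [particlesAt, shift]
  refine tsum_congr fun k => Finset.sum_congr rfl fun i _ => ?_
  congr 3
  abel

variable {P : Measure (Config d)}

lemma lintegral_particlesAt (hG : IsMarkFamily G) (hP : P ∈ stationary d) {m : ℕ+ → ℝ≥0} {ρ : ℝ≥0}
    (hm : ∀ k, ∫⁻ ω, (ω (0, k) : ℝ≥0∞) ∂P = m k)
    (hρ : HasSum (fun k : ℕ+ => ((k : ℕ) : ℝ≥0) * m k) ρ) (x : Site d) :
    ∫⁻ ω, particlesAt G x ω ∂P = ρ := by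
  unfold particlesAt
  rw [lintegral_tsum fun k => (Finset.measurable_fun_sum _ fun i _ =>
    measurable_natCast_apply _).aemeasurable, ← coe_hasSum hρ]
  refine tsum_congr fun k => ?_
  rw [lintegral_finsetSum _ fun i _ => measurable_natCast_apply _]
  have h : ∀ i, ∫⁻ ω, (ω (x - i, k) : ℝ≥0∞) ∂P = m k := fun i =>
    (lintegral_apply_eq_of_mem_stationary hP (x - i, k)).trans (hm k)
  simp only [h, Finset.sum_const, (hG k).1, nsmul_eq_mul]

lemma lintegral_particlesAt_sq (hP : P ∈ stationary d) (x : Site d) :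
    ∫⁻ ω, particlesAt G x ω * particlesAt G x ω ∂P
      = ∫⁻ ω, particlesAt G 0 ω * particlesAt G 0 ω ∂P := by
  conv_rhs => rw [← hP.2 x]
  rw [lintegral_map (by have := measurable_particlesAt G 0; fun_prop) (measurable_shift _)]
  simp only [particlesAt_eq_shift x]

lemma lintegral_mul_eq_pairMoment (hP : P ∈ stationary d) (x y : Site d) (k l : ℕ+) :
    ∫⁻ ω, (ω (x, k) : ℝ≥0∞) * (ω (y, l) : ℝ≥0∞) ∂P = pairMoment P (y - x) k l := by
  unfold pairMoment
  conv_rhs => rw [← hP.2 x]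
  rw [lintegral_map (by fun_prop) (measurable_shift _)]
  simp [shift]

lemma lintegral_particlesAt_mul (hP : P ∈ stationary d) (x : Site d) :
    ∫⁻ ω, particlesAt G 0 ω * particlesAt G x ω ∂P
      = ∑' (k : ℕ+) (l : ℕ+), ∑ i ∈ G k, ∑ j ∈ G l, pairMoment P (x - j + i) k l := by
  have h : ∀ ω : Config d, particlesAt G 0 ω * particlesAt G x ω
      = ∑' (k : ℕ+) (l : ℕ+), ∑ i ∈ G k, ∑ j ∈ G l,
        (ω (0 - i, k) : ℝ≥0∞) * (ω (x - j, l) : ℝ≥0∞) := fun ω => by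
    unfold particlesAt
    rw [← ENNReal.tsum_mul_right]
    refine tsum_congr fun k => ?_
    rw [← ENNReal.tsum_mul_left]
    exact tsum_congr fun l => Finset.sum_mul_sum _ _ _ _
  simp only [h]
  have h1 : ∀ k l i j, Measurable fun ω : Config d =>
      (ω (0 - i, k) : ℝ≥0∞) * (ω (x - j, l) : ℝ≥0∞) := fun k l i j => by fun_prop
  have h2 : ∀ k l, Measurable fun ω : Config d => ∑ i ∈ G k, ∑ j ∈ G l,
      (ω (0 - i, k) : ℝ≥0∞) * (ω (x - j, l) : ℝ≥0∞) := fun k l =>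
    Finset.measurable_fun_sum _ fun i _ => Finset.measurable_fun_sum _ fun j _ => h1 k l i j
  rw [lintegral_tsum fun k => (Measurable.tsum (h2 k)).aemeasurable]
  refine tsum_congr fun k => ?_
  rw [lintegral_tsum fun l => (h2 k l).aemeasurable]
  refine tsum_congr fun l => ?_
  rw [lintegral_finsetSum _ fun i _ => Finset.measurable_fun_sum _ fun j _ => h1 k l i j]
  refine Finset.sum_congr rfl fun i _ => ?_
  rw [lintegral_finsetSum _ fun j _ => h1 k l i j]
  refine Finset.sum_congr rfl fun j _ => ?_
  rw [lintegral_mul_eq_pairMoment hP, zero_sub, sub_neg_eq_add]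

/-- The mean energy per site, in terms of the particles instead of the marked points. -/
lemma lintegral_energyAtOrigin_eq_tsum_particlesAt (hP : P ∈ stationary d) (v : Site d → ℝ≥0) :
    ∫⁻ ω, energyAtOrigin G v ω ∂P
      = ∑' x, (v (-x) : ℝ≥0∞) * ∫⁻ ω, particlesAt G 0 ω * particlesAt G x ω ∂P := by
  simp only [lintegral_energyAtOrigin, lintegral_particlesAt_mul hP, ← ENNReal.tsum_mul_left,
    Finset.mul_sum]
  rw [ENNReal.tsum_comm]
  conv_rhs => rw [ENNReal.tsum_comm]
  refine tsum_congr fun k => ?_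
  rw [ENNReal.tsum_comm]
  conv_rhs => rw [ENNReal.tsum_comm]
  refine tsum_congr fun l => ?_
  simp only [pairEnergy, ENNReal.ofNNReal_finsetSum, Finset.mul_sum]
  rw [Summable.tsum_finsetSum fun _ _ => ENNReal.summable]
  conv_rhs => rw [Summable.tsum_finsetSum fun _ _ => ENNReal.summable]
  refine Finset.sum_congr rfl fun i _ => ?_
  rw [Summable.tsum_finsetSum fun _ _ => ENNReal.summable]
  conv_rhs => rw [Summable.tsum_finsetSum fun _ _ => ENNReal.summable]
  refine Finset.sum_congr rfl fun j _ => ?_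
  -- Two points at `0` and `y` place their particles `i` and `j` at displacement `x = y + j - i`.
  -- Substituting `y = x + (i - j)` sums over that displacement.
  rw [← (Equiv.addRight (i - j)).tsum_eq]
  refine tsum_congr fun x => ?_
  have e1 : 0 + i - (x + (i - j)) - j = -x := by abel
  have e2 : x + (i - j) = x - j + i := by abel
  simp only [Equiv.coe_addRight]
  rw [mul_comm, e1, e2]

/-- This is `(a + b - 2ρ)² ≥ 0` without subtraction, so that infinite values are allowed. -/
lemma four_mul_le_sq_add (ρ : ℝ≥0) (a b : ℝ≥0∞) :
    4 * (ρ : ℝ≥0∞) * (a + b) ≤ a * a + b * b + 2 * (a * b) + 4 * (ρ : ℝ≥0∞) ^ 2 := by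
  by_cases ha : a = ∞
  · simp [ha]
  by_cases hb : b = ∞
  · simp [hb]
  lift a to ℝ≥0 using ha
  lift b to ℝ≥0 using hb
  norm_cast
  rw [← NNReal.coe_le_coe]
  push_cast
  nlinarith [sq_nonneg ((a : ℝ) + b - 2 * ρ)]

/-- The second moment of the sum of the particle numbers at `0` and `x` is at least the square `4ρ²`
of its mean, and stationarity equates the two diagonal terms. -/
lemma two_mul_sq_le_lintegral_particlesAt (hG : IsMarkFamily G) (hP : P ∈ stationary d)
    {m : ℕ+ → ℝ≥0} {ρ : ℝ≥0} (hm : ∀ k, ∫⁻ ω, (ω (0, k) : ℝ≥0∞) ∂P = m k)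
    (hρ : HasSum (fun k : ℕ+ => ((k : ℕ) : ℝ≥0) * m k) ρ) (x : Site d) :
    2 * (ρ : ℝ≥0∞) ^ 2 ≤ ∫⁻ ω, particlesAt G 0 ω * particlesAt G x ω ∂P
      + ∫⁻ ω, particlesAt G 0 ω * particlesAt G 0 ω ∂P := by
  have := hP.1
  have h0 := measurable_particlesAt G 0
  have hx := measurable_particlesAt G x
  have h := lintegral_mono (μ := P) fun ω =>
    four_mul_le_sq_add ρ (particlesAt G 0 ω) (particlesAt G x ω)
  rw [lintegral_const_mul _ (by fun_prop), lintegral_add_left h0, lintegral_add_left (by fun_prop),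
    lintegral_add_left (by fun_prop), lintegral_add_left (by fun_prop),
    lintegral_const_mul _ (by fun_prop), lintegral_particlesAt hG hP hm hρ,
    lintegral_particlesAt hG hP hm hρ, lintegral_particlesAt_sq hP x, lintegral_const, measure_univ,
    mul_one] at h
  set E := ∫⁻ ω, particlesAt G 0 ω * particlesAt G 0 ω ∂P
  set C := ∫⁻ ω, particlesAt G 0 ω * particlesAt G x ω ∂P
  have h1 : 4 * (ρ : ℝ≥0∞) * (ρ + ρ) = 2 * (2 * (ρ : ℝ≥0∞) ^ 2) + 4 * (ρ : ℝ≥0∞) ^ 2 := by ring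
  have h2 : E + E + 2 * C = 2 * (C + E) := by ring
  rw [h1, h2] at h
  have h3 := (ENNReal.add_le_add_iff_right (by finiteness)).1 h
  exact (ENNReal.mul_le_mul_iff_right two_ne_zero ENNReal.ofNat_ne_top).1 h3

/-- Let `S` be the mass of `v` off the origin. The hypothesis says `S ≤ v 0`, so `v 0 = S + t`. Each
unit of `S` pairs `C x` with `C 0`, giving at least `2ρ²`, and the remainder gives `t C 0 ≥ tρ²`;
together `(2S + t)ρ² = v̄ρ²`. -/
lemma vbar_mul_sq_le_lintegral_energyAtOrigin (hG : IsMarkFamily G) {v : Site d → ℝ≥0}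
    (hv : (Function.support v).Finite) (hv0 : vbar v ≤ 2 * v 0) (hP : P ∈ stationary d)
    {m : ℕ+ → ℝ≥0} {ρ : ℝ≥0} (hm : ∀ k, ∫⁻ ω, (ω (0, k) : ℝ≥0∞) ∂P = m k)
    (hρ : HasSum (fun k : ℕ+ => ((k : ℕ) : ℝ≥0) * m k) ρ) :
    (vbar v : ℝ≥0∞) * (ρ : ℝ≥0∞) ^ 2 ≤ ∫⁻ ω, energyAtOrigin G v ω ∂P := by
  have hkey := two_mul_sq_le_lintegral_particlesAt hG hP hm hρ
  rw [lintegral_energyAtOrigin_eq_tsum_particlesAt hP]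
  set C : Site d → ℝ≥0∞ := fun x => ∫⁻ ω, particlesAt G 0 ω * particlesAt G x ω ∂P with hC
  have hsplit : ∑' x, (v (-x) : ℝ≥0∞) * C x
      = (v (-0) : ℝ≥0∞) * C 0 + ∑' x : Site d, if x = 0 then 0 else (v (-x) : ℝ≥0∞) * C x := by
    rw [ENNReal.tsum_eq_add_tsum_ite 0]
    congr!
  set S : ℝ≥0∞ := ∑' x : Site d, if x = 0 then 0 else (v (-x) : ℝ≥0∞) with hS
  have hvbar : (vbar v : ℝ≥0∞) = v 0 + S := by
    rw [← tsum_coe_eq_vbar hv, ← (Equiv.neg (Site d)).tsum_eq, ENNReal.tsum_eq_add_tsum_ite 0]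
    simp [hS]
  have hSv : S ≤ v 0 := by
    have h1 : (v 0 : ℝ≥0∞) + S ≤ v 0 + v 0 := by
      rw [← hvbar, ← two_mul]
      exact_mod_cast hv0
    exact (ENNReal.add_le_add_iff_left ENNReal.coe_ne_top).1 h1
  obtain ⟨t, ht⟩ := exists_add_of_le hSv
  have hE : (ρ : ℝ≥0∞) ^ 2 ≤ C 0 := by
    have h1 := hkey 0
    rw [← two_mul] at h1
    exact (ENNReal.mul_le_mul_iff_right two_ne_zero ENNReal.ofNat_ne_top).1 h1
  calc (vbar v : ℝ≥0∞) * (ρ : ℝ≥0∞) ^ 2 = t * (ρ : ℝ≥0∞) ^ 2 + S * (2 * (ρ : ℝ≥0∞) ^ 2) := by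
        rw [hvbar, ht]
        ring
    _ ≤ t * C 0 + ∑' x : Site d, (if x = 0 then 0 else (v (-x) : ℝ≥0∞)) * (C x + C 0) := by
        rw [hS, ← ENNReal.tsum_mul_right]
        exact add_le_add (mul_le_mul_right hE _)
          (ENNReal.tsum_le_tsum fun x => mul_le_mul_right (hkey x) _)
    _ = (v (-0) : ℝ≥0∞) * C 0 + ∑' x : Site d, if x = 0 then 0 else (v (-x) : ℝ≥0∞) * C x := by
        simp only [mul_add]
        rw [ENNReal.tsum_add, ENNReal.tsum_mul_right, ← hS, neg_zero, ht]
        simp only [ite_mul, zero_mul]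
        ring
    _ ≤ _ := hsplit.ge

end LowerBound

end BoxBoseGas

/-! ### The case `ρ_ma = 0`, finiteness of `χ` and its slope at the origin. -/

namespace BoxBoseGas

variable {d : ℕ} {G : ℕ+ → Finset (Site d)} {v : Site d → ℝ≥0} {q : ℕ+ → ℝ≥0}

section NoMacroscopic

lemma eq_deltaZero {ψ : ℕ → ℝ≥0} (h1 : ψ ∈ probs) (h2 : HasSum (fun a : ℕ => (a : ℝ≥0) * ψ a) 0) :
    ψ = deltaZero := by
  rw [hasSum_zero_iff] at h2
  have h3 : ∀ a ≠ 0, ψ a = 0 := fun a ha => by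
    simpa [ha] using h2 a
  funext a
  rcases eq_or_ne a 0 with rfl | ha
  · simpa [deltaZero] using (hasSum_single 0 h3).unique h1
  · simp [deltaZero, ha, h3 a ha]

lemma hasSum_mul_deltaZero : HasSum (fun a : ℕ => (a : ℝ≥0) * deltaZero a) 0 := by
  convert! hasSum_zero using 2 with a
  rcases eq_or_ne a 0 with rfl | ha
  · simp
  · simp [deltaZero, ha]

lemma mem_feasible_zero_iff {ρ : ℝ≥0} {m : ℕ+ → ℝ≥0} {ψ : ℕ → ℝ≥0} :
    (m, ψ) ∈ feasible ρ 0 ↔ HasSum (fun k : ℕ+ => ((k : ℕ) : ℝ≥0) * m k) ρ ∧ ψ = deltaZero :=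
  ⟨fun ⟨h1, h2, h3⟩ => ⟨h1, eq_deltaZero h2 h3⟩,
    fun ⟨h1, h2⟩ => ⟨h1, h2 ▸ deltaZero_mem_probs, by
      change HasSum (fun a : ℕ => (a : ℝ≥0) * ψ a) 0
      exact h2 ▸ hasSum_mul_deltaZero⟩⟩

lemma tsum_single_mul (n : ℕ) (f : ℕ → ℝ≥0∞) :
    ∑' a, ((Pi.single n 1 : ℕ → ℝ≥0) a : ℝ≥0∞) * f a = f n := by
  rw [tsum_eq_single n fun a ha => by simp [ha]]
  simp

lemma phi_single_le {n : ℕ} {m : ℕ+ → ℝ≥0} {P : Measure (Config d)} (hP : P ∈ stationary d)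
    (hm : ∀ k, ∫⁻ ω, (ω (0, k) : ℝ≥0∞) ∂P = m k) :
    phi G v q m (Pi.single n 1) ≤ cost G v q n P :=
  (phi_le (P := fun _ => P) ⟨fun _ => hP, fun k => by rw [tsum_single_mul, hm]⟩).trans_eq
    (tsum_single_mul n _)

lemma cost_zero (P : Measure (Config d)) :
    cost G v q 0 P = entropyDensity q P + ∫⁻ ω, energyAtOrigin G v ω ∂P := by
  simp [cost]

lemma le_phi_deltaZero {m : ℕ+ → ℝ≥0} {z : ℝ≥0∞}
    (h : ∀ P ∈ stationary d, (∀ k, ∫⁻ ω, (ω (0, k) : ℝ≥0∞) ∂P = m k) →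
      z ≤ entropyDensity q P + ∫⁻ ω, energyAtOrigin G v ω ∂P) : z ≤ phi G v q m deltaZero := by
  refine le_iInf₂ fun P ⟨hP, hPm⟩ => ?_
  refine (h (P 0) (hP 0) fun k => ?_).trans_eq ?_
  · rw [← hPm k]
    exact (tsum_single_mul 0 fun a => ∫⁻ ω, (ω (0, k) : ℝ≥0∞) ∂(P a)).symm
  · rw [← cost_zero]
    exact (tsum_single_mul 0 fun a => cost G v q a (P a)).symm

/-- The competitor is the Poisson process with intensities `m`, whose entropy density is exactly
`relEntropy m q`. -/
lemma phi_deltaZero_le (hG : IsMarkFamily G) (hv : (Function.support v).Finite)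
    (hq : ∀ k, 0 < q k) {m : ℕ+ → ℝ≥0} {ρ : ℝ≥0}
    (hρ : HasSum (fun k : ℕ+ => ((k : ℕ) : ℝ≥0) * m k) ρ) :
    phi G v q m deltaZero ≤ relEntropy m q + vbar v * ((ρ : ℝ≥0∞) ^ 2 + ρ) := by
  refine (phi_single_le (poissonProcess_mem_stationary m) fun k =>
    lintegral_poissonProcess m (0, k)).trans ?_
  rw [cost_zero, entropyDensity_poissonProcess hq]
  gcongr
  exact lintegral_energyAtOrigin_poissonProcess_le hG hv hρ

lemma relEntropy_le_phi_deltaZero (hq : ∀ k, 0 < q k) (m : ℕ+ → ℝ≥0) :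
    relEntropy m q ≤ phi G v q m deltaZero :=
  le_phi_deltaZero fun _ hP hm => (relEntropy_le_entropyDensity hP hq hm).trans le_self_add

lemma vbar_zero : vbar (0 : Site d → ℝ≥0) = 0 := by simp [vbar]

lemma finite_support_zero : (Function.support (0 : Site d → ℝ≥0)).Finite := by simp

lemma chi_le_chi_zero_add (hG : IsMarkFamily G) (hv : (Function.support v).Finite)
    (hq : ∀ k, 0 < q k) (ρ : ℝ≥0) :
    chi G v q ρ 0 ≤ chi G 0 q ρ 0 + vbar v * ((ρ : ℝ≥0∞) ^ 2 + ρ) := by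
  rw [← tsub_le_iff_right]
  refine le_chi fun m ψ h => ?_
  obtain ⟨hρ, rfl⟩ := mem_feasible_zero_iff.1 h
  rw [tsub_le_iff_right]
  exact (chi_le h).trans ((phi_deltaZero_le hG hv hq hρ).trans
    (add_le_add_left (relEntropy_le_phi_deltaZero hq m) _))

lemma chi_zero_add_le_chi (hG : IsMarkFamily G) (hv : (Function.support v).Finite)
    (hq : ∀ k, 0 < q k) (hv0 : vbar v ≤ 2 * v 0) (ρ : ℝ≥0) :
    chi G 0 q ρ 0 + vbar v * (ρ : ℝ≥0∞) ^ 2 ≤ chi G v q ρ 0 := by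
  refine le_chi fun m ψ h => ?_
  obtain ⟨hρ, rfl⟩ := mem_feasible_zero_iff.1 h
  refine le_phi_deltaZero fun P hP hm => add_le_add ?_
    (vbar_mul_sq_le_lintegral_energyAtOrigin hG hv hv0 hP hm hρ)
  -- For `v = 0` the Poisson bound has no energy term, so the non-interacting `χ` is at most
  -- `relEntropy m q`.
  refine (chi_le h).trans ((phi_deltaZero_le hG finite_support_zero hq hρ).trans ?_)
  rw [vbar_zero, ENNReal.coe_zero, zero_mul, add_zero]
  exact relEntropy_le_entropyDensity hP hq hm

lemma siteEntropy_zero (q : ℝ≥0) : siteEntropy 0 q = q := by simp [siteEntropy]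

lemma relEntropy_zero (q : ℕ+ → ℝ≥0) : relEntropy 0 q = ∑' k, (q k : ℝ≥0∞) := by
  rw [relEntropy_eq_tsum]
  exact tsum_congr fun k => by rw [Pi.zero_apply, siteEntropy_zero, ENNReal.ofReal_coe_nnreal]

lemma hasSum_mul_zero : HasSum (fun k : ℕ+ => ((k : ℕ) : ℝ≥0) * (0 : ℕ+ → ℝ≥0) k) 0 := by
  simp

lemma chi_zero_zero (hG : IsMarkFamily G) (hv : (Function.support v).Finite)
    (hq : ∀ k, 0 < q k) : chi G v q 0 0 = ∑' k, (q k : ℝ≥0∞) := by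
  rw [← relEntropy_zero]
  refine le_antisymm ?_ (le_chi fun m ψ h => ?_)
  · refine (chi_le (mem_feasible_zero_iff.2 ⟨hasSum_mul_zero, rfl⟩)).trans
      ((phi_deltaZero_le hG hv hq hasSum_mul_zero).trans ?_)
    simp
  · obtain ⟨hρ, rfl⟩ := mem_feasible_zero_iff.1 h
    rw [hasSum_zero_iff] at hρ
    have hm : m = 0 := funext fun k => by simpa using hρ k
    rw [hm]
    exact relEntropy_le_phi_deltaZero hq 0

end NoMacroscopic

section Finiteness

/-- All particles sit in marks of size one. -/
lemma hasSum_mul_single (ρ : ℝ≥0) :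
    HasSum (fun k : ℕ+ => ((k : ℕ) : ℝ≥0) * (Pi.single 1 ρ : ℕ+ → ℝ≥0) k) ρ := by
  convert! hasSum_single (f := fun k : ℕ+ => ((k : ℕ) : ℝ≥0) * (Pi.single 1 ρ : ℕ+ → ℝ≥0) k) 1 ?_
    using 1
  · simp
  · intro k hk
    simp [hk]

lemma relEntropy_single_add (q : ℕ+ → ℝ≥0) (ρ : ℝ≥0) :
    relEntropy (Pi.single 1 ρ) q + q 1
      = ENNReal.ofReal (siteEntropy ρ (q 1)) + ∑' k, (q k : ℝ≥0∞) := by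
  rw [relEntropy_eq_tsum, ENNReal.tsum_eq_add_tsum_ite 1,
    ENNReal.tsum_eq_add_tsum_ite (f := fun k => (q k : ℝ≥0∞)) 1]
  rw [Pi.single_eq_same, add_right_comm, add_assoc]
  congr 2
  refine tsum_congr fun k => ?_
  by_cases hk : k = 1
  · simp [hk]
  · simp [hk, siteEntropy_zero]

lemma tsum_coe_ne_top (hqsum : Summable q) : ∑' k, (q k : ℝ≥0∞) ≠ ∞ :=
  ENNReal.tsum_coe_ne_top_iff_summable.2 hqsum

lemma relEntropy_single_ne_top (hqsum : Summable q) (ρ : ℝ≥0) :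
    relEntropy (Pi.single 1 ρ) q ≠ ∞ := fun h => by
  have h1 := relEntropy_single_add q ρ
  rw [h, top_add] at h1
  exact ENNReal.add_ne_top.2 ⟨ENNReal.ofReal_ne_top, tsum_coe_ne_top hqsum⟩ h1.symm

lemma lintegral_particlesAtOrigin_poissonProcess {m : ℕ+ → ℝ≥0} {ρ : ℝ≥0}
    (hρ : HasSum (fun k : ℕ+ => ((k : ℕ) : ℝ≥0) * m k) ρ) :
    ∫⁻ ω, particlesAtOrigin ω ∂(poissonProcess d m) = ρ := by
  unfold particlesAtOrigin
  rw [lintegral_tsum fun k => ((measurable_natCast_apply _).const_mul _).aemeasurable,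
    ← coe_hasSum hρ]
  refine tsum_congr fun k => ?_
  rw [lintegral_const_mul _ (measurable_natCast_apply _), lintegral_poissonProcess]

/-- By monotonicity `ρma` may be rounded up to an integer `n`. Then `ψ` can be the point mass at
`n`, with a Poisson process of marks of size one. -/
lemma chi_ne_top (hG : IsMarkFamily G) (hv : (Function.support v).Finite)
    (hq : ∀ k, 0 < q k) (hqsum : Summable q) (ρmi ρma : ℝ≥0) : chi G v q ρmi ρma ≠ ∞ := by
  obtain ⟨n, hn⟩ := exists_nat_ge ρma
  refine ne_top_of_le_ne_top ?_ (monotone_chi ρmi hn)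
  have hfeas : ((Pi.single 1 ρmi : ℕ+ → ℝ≥0), (Pi.single n 1 : ℕ → ℝ≥0)) ∈ feasible ρmi n := by
    refine ⟨hasSum_mul_single ρmi, hasSum_pi_single n 1, ?_⟩
    convert! hasSum_single (f := fun a : ℕ => (a : ℝ≥0) * (Pi.single n 1 : ℕ → ℝ≥0) a) n ?_ using 1
    · simp
    · intro a ha
      simp [ha]
  refine ne_top_of_le_ne_top ?_ ((chi_le hfeas).trans (phi_single_le
    (poissonProcess_mem_stationary _) fun k => lintegral_poissonProcess _ (0, k)))
  have h1 := lintegral_energyAtOrigin_poissonProcess_le hG hv (hasSum_mul_single ρmi)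
  have h2 : ∫⁻ ω, energyAtOrigin G v ω ∂(poissonProcess d (Pi.single 1 ρmi)) ≠ ∞ :=
    ne_top_of_le_ne_top (by finiteness) h1
  have h3 := relEntropy_single_ne_top hqsum ρmi
  rw [cost, entropyDensity_poissonProcess hq,
    lintegral_particlesAtOrigin_poissonProcess (hasSum_mul_single ρmi)]
  finiteness

end Finiteness

section Slope

/-- With marks of size one only, the entropy exceeds its value at `m = 0` by `-ρ + ρ log (ρ / q 1)`.
Division by `ρ` leaves `log ρ` plus bounded terms. -/
lemma toReal_chi_le (hG : IsMarkFamily G) (hv : (Function.support v).Finite)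
    (hq : ∀ k, 0 < q k) (hqsum : Summable q) {ρ : ℝ≥0} (hρ : 0 < ρ) :
    ((chi G v q ρ 0).toReal - (chi G v q 0 0).toReal) / (ρ : ℝ)
      ≤ Real.log ρ + (- Real.log (q 1) - 1 + vbar v * (ρ + 1)) := by
  have h1 : chi G v q ρ 0 ≤ relEntropy (Pi.single 1 ρ) q + vbar v * ((ρ : ℝ≥0∞) ^ 2 + ρ) :=
    (chi_le (mem_feasible_zero_iff.2 ⟨hasSum_mul_single ρ, rfl⟩)).trans
      (phi_deltaZero_le hG hv hq (hasSum_mul_single ρ))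
  have h2 : chi G v q ρ 0 + q 1 ≤ ENNReal.ofReal (siteEntropy ρ (q 1)) + chi G v q 0 0
      + vbar v * ((ρ : ℝ≥0∞) ^ 2 + ρ) := by
    rw [chi_zero_zero hG hv hq, ← relEntropy_single_add, add_right_comm]
    exact add_le_add_left h1 _
  have hfin := chi_ne_top hG hv hq hqsum
  have h3 := ENNReal.toReal_mono (by have := hfin 0 0; finiteness) h2
  rw [ENNReal.toReal_add (hfin _ _) ENNReal.coe_ne_top,
    ENNReal.toReal_add (by have := hfin 0 0; finiteness) (by finiteness),
    ENNReal.toReal_add ENNReal.ofReal_ne_top (hfin _ _),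
    ENNReal.toReal_ofReal (siteEntropy_nonneg ρ (hq 1)), ENNReal.toReal_mul,
    ENNReal.toReal_add (by finiteness) (by finiteness), ENNReal.toReal_pow] at h3
  simp only [ENNReal.coe_toReal] at h3
  have hρ' : (0 : ℝ) < ρ := by exact_mod_cast hρ
  have hq1 : (0 : ℝ) < q 1 := by exact_mod_cast hq 1
  rw [siteEntropy, Real.log_div hρ'.ne' hq1.ne'] at h3
  rw [div_le_iff₀ hρ']
  linarith

lemma tendsto_slope_chi (hG : IsMarkFamily G) (hv : (Function.support v).Finite)
    (hq : ∀ k, 0 < q k) (hqsum : Summable q) :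
    Tendsto (fun ρ : ℝ≥0 => ((chi G v q ρ 0).toReal - (chi G v q 0 0).toReal) / (ρ : ℝ))
      (𝓝[>] 0) atBot := by
  refine tendsto_atBot_mono' (𝓝[>] 0) (f₁ := fun ρ : ℝ≥0 => Real.log ρ
    + (- Real.log (q 1) - 1 + vbar v * ((ρ : ℝ) + 1))) ?_ ?_
  · filter_upwards [self_mem_nhdsWithin] with ρ hρ
    exact toReal_chi_le hG hv hq hqsum hρ
  · have hcoe : Tendsto (fun ρ : ℝ≥0 => (ρ : ℝ)) (𝓝[>] 0) (𝓝[>] 0) := by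
      refine tendsto_nhdsWithin_iff.2 ⟨?_, ?_⟩
      · exact (NNReal.continuous_coe.tendsto' 0 0 rfl).mono_left nhdsWithin_le_nhds
      · filter_upwards [self_mem_nhdsWithin] with ρ hρ
        exact NNReal.coe_pos.2 hρ
    refine (Real.tendsto_log_nhdsGT_zero.comp hcoe).atBot_add
      (C := - Real.log (q 1) - 1 + vbar v * (0 + 1)) ?_
    refine Tendsto.mono_left ?_ nhdsWithin_le_nhds
    exact Continuous.tendsto' (by fun_prop) _ _ (by simp)

end Slope

/-! ### Lower bound near `ρ_mi = 0` and joint continuity of `χ`. -/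

section LowerBound

/-- Equivalent to `siteEntropy m (s * q) ≥ 0`: the reference intensity is lowered by the factor `s`,
which is chosen later to balance the two error terms. -/
lemma le_siteEntropy {m q s : ℝ≥0} (hq : 0 < q) (hs : 0 < s) :
    q ≤ siteEntropy m q + s * q + (- Real.log s) * m := by
  have h := siteEntropy_nonneg m (mul_pos hs hq)
  rcases eq_or_ne m 0 with rfl | hm
  · rw [siteEntropy_zero]
    simp
    positivity
  have hm' : (m : ℝ) ≠ 0 := by exact_mod_cast hm
  have hq' : (q : ℝ) ≠ 0 := by exact_mod_cast hq.ne'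
  have hs' : (s : ℝ) ≠ 0 := by exact_mod_cast hs.ne'
  rw [siteEntropy, NNReal.coe_mul, Real.log_div hm' (mul_ne_zero hs' hq'),
    Real.log_mul hs' hq'] at h
  rw [siteEntropy, Real.log_div hm' hq']
  linarith

lemma tsum_le_relEntropy_add (hq : ∀ k, 0 < q k) {m : ℕ+ → ℝ≥0} {ρ : ℝ≥0}
    (hρ : HasSum (fun k : ℕ+ => ((k : ℕ) : ℝ≥0) * m k) ρ) {s : ℝ≥0} (hs : 0 < s) (hs1 : s ≤ 1) :
    ∑' k, (q k : ℝ≥0∞) ≤ relEntropy m q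
      + (s * ∑' k, (q k : ℝ≥0∞) + ENNReal.ofReal (- Real.log s) * ρ) := by
  have hlog : 0 ≤ - Real.log s := by
    have := Real.log_nonpos s.coe_nonneg (by exact_mod_cast hs1)
    linarith
  rw [relEntropy_eq_tsum, ← coe_hasSum hρ, ← ENNReal.tsum_mul_left, ← ENNReal.tsum_mul_left,
    ← ENNReal.tsum_add, ← ENNReal.tsum_add]
  refine ENNReal.tsum_le_tsum fun k => ?_
  have h1 : (m k : ℝ≥0∞) ≤ ((k : ℕ) : ℝ≥0∞) * m k := by
    refine le_mul_of_one_le_left zero_le ?_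
    exact_mod_cast k.2
  have h2 : (q k : ℝ≥0∞) ≤ ENNReal.ofReal (siteEntropy (m k) (q k))
      + (s * q k + ENNReal.ofReal (- Real.log s) * m k) := by
    rw [← ENNReal.ofReal_coe_nnreal (p := s), ← ENNReal.ofReal_coe_nnreal (p := q k),
      ← ENNReal.ofReal_coe_nnreal (p := m k), ← ENNReal.ofReal_mul s.coe_nonneg, ← ENNReal.ofReal_mul hlog,
      ← ENNReal.ofReal_add (by positivity) (mul_nonneg hlog (m k).coe_nonneg),
      ← ENNReal.ofReal_add (siteEntropy_nonneg _ (hq k))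
        (add_nonneg (by positivity) (mul_nonneg hlog (m k).coe_nonneg))]
    refine ENNReal.ofReal_le_ofReal ?_
    linarith [le_siteEntropy (m := m k) (hq k) hs]
  refine h2.trans ?_
  gcongr

/-- The mixture `∑ ψ(a) P_a` is stationary with intensities `m`, and the entropy density is convex.
-/
lemma relEntropy_le_tsum_entropyDensity (hq : ∀ k, 0 < q k) {m : ℕ+ → ℝ≥0} {ψ : ℕ → ℝ≥0}
    (hψ : ψ ∈ probs) {P : ℕ → Measure (Config d)} (hP : P ∈ admissible d m ψ) :
    relEntropy m q ≤ ∑' a, (ψ a : ℝ≥0∞) * entropyDensity q (P a) := by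
  have hsum : ∑' a, (ψ a : ℝ≥0∞) = 1 := by
    simpa using (ENNReal.hasSum_coe.2 hψ).tsum_eq
  refine (relEntropy_le_entropyDensity (sum_smul_mem_stationary hsum hP.1) hq fun k => ?_).trans
    (entropyDensity_sum_smul_le hsum hP.1)
  rw [lintegral_sum_measure, ← hP.2 k]
  simp only [lintegral_smul_measure, smul_eq_mul]

/-- Keep `ψ` and replace every `P_a` by the empty configuration. Energy and mixed terms vanish, the
`v̄a²` terms agree, and the entropy rises by at most the error of `tsum_le_relEntropy_add`. -/
lemma chi_zero_left_le (hG : IsMarkFamily G) (hv : (Function.support v).Finite)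
    (hq : ∀ k, 0 < q k) (ρmi ρma : ℝ≥0) {s : ℝ≥0} (hs : 0 < s) (hs1 : s ≤ 1) :
    chi G v q 0 ρma ≤ chi G v q ρmi ρma
      + (s * ∑' k, (q k : ℝ≥0∞) + ENNReal.ofReal (- Real.log s) * ρmi) := by
  rw [← tsub_le_iff_right]
  refine le_chi fun m ψ ⟨h1, h2, h3⟩ => le_iInf₂ fun P hP => ?_
  rw [tsub_le_iff_right]
  have hsum : ∑' a, (ψ a : ℝ≥0∞) = 1 := by
    simpa using (ENNReal.hasSum_coe.2 h2).tsum_eq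
  have hup : chi G v q 0 ρma ≤ ∑' k, (q k : ℝ≥0∞)
      + ∑' a, (ψ a : ℝ≥0∞) * ((vbar v : ℝ≥0∞) * (a : ℝ≥0∞) ^ 2) := by
    refine (chi_le (m := 0) (ψ := ψ) ⟨hasSum_mul_zero, h2, h3⟩).trans
      ((phi_le (P := fun _ => poissonProcess d 0)
        ⟨fun _ => poissonProcess_mem_stationary 0, fun k => ?_⟩).trans_eq ?_)
    · simp [lintegral_poissonProcess]
    · have he : ∫⁻ ω, energyAtOrigin G v ω ∂(poissonProcess d 0) = 0 := by
        have := lintegral_energyAtOrigin_poissonProcess_le hG hv hasSum_mul_zero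
        simpa using this
      simp only [cost, entropyDensity_poissonProcess hq, he,
        lintegral_particlesAtOrigin_poissonProcess hasSum_mul_zero, relEntropy_zero]
      simp only [ENNReal.coe_zero, mul_zero, add_zero, mul_add, ENNReal.tsum_add,
        ENNReal.tsum_mul_right, hsum, one_mul]
  have hlow : relEntropy m q + ∑' a, (ψ a : ℝ≥0∞) * ((vbar v : ℝ≥0∞) * (a : ℝ≥0∞) ^ 2)
      ≤ ∑' a, (ψ a : ℝ≥0∞) * cost G v q a (P a) := by
    refine (add_le_add_left (relEntropy_le_tsum_entropyDensity hq h2 hP) _).trans ?_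
    rw [← ENNReal.tsum_add]
    refine ENNReal.tsum_le_tsum fun a => ?_
    rw [← mul_add]
    refine mul_le_mul_right (add_le_add_left ?_ _) _
    rw [add_assoc]
    exact le_self_add
  refine hup.trans ((add_le_add_left (tsum_le_relEntropy_add hq h1 hs hs1) _).trans ?_)
  rw [add_right_comm]
  exact add_le_add_left hlow _

end LowerBound

section Continuity

lemma convexOn_slice_right {F : ℝ × ℝ → ℝ} (hF : ConvexOn ℝ (Set.Ici 0 ×ˢ Set.Ici 0) F) {c : ℝ}
    (hc : 0 ≤ c) : ConvexOn ℝ (Set.Ici 0) fun y => F (c, y) := by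
  refine ⟨convex_Ici 0, fun y hy y' hy' a b ha hb hab => ?_⟩
  have h := hF.2 (x := (c, y)) (y := (c, y')) ⟨hc, hy⟩ ⟨hc, hy'⟩ ha hb hab
  have hc' : a * c + b * c = c := by rw [← add_mul, hab, one_mul]
  simpa [hc'] using h

lemma convexOn_slice_left {F : ℝ × ℝ → ℝ} (hF : ConvexOn ℝ (Set.Ici 0 ×ˢ Set.Ici 0) F) {c : ℝ}
    (hc : 0 ≤ c) : ConvexOn ℝ (Set.Ici 0) fun x => F (x, c) := by
  refine ⟨convex_Ici 0, fun y hy y' hy' a b ha hb hab => ?_⟩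
  have h := hF.2 (x := (y, c)) (y := (y', c)) ⟨hy, hc⟩ ⟨hy', hc⟩ ha hb hab
  have hc' : a * c + b * c = c := by rw [← add_mul, hab, one_mul]
  simpa [hc'] using h

lemma continuousAt_of_convexOn {f : ℝ → ℝ} (hf : ConvexOn ℝ (Set.Ici 0) f) {x : ℝ}
    (hx : 0 < x) : ContinuousAt f x :=
  hf.continuousOn_interior.continuousAt (by
    rw [interior_Ici]
    exact Ioi_mem_nhds hx)

lemma le_chord_of_convexOn {f : ℝ → ℝ} (hf : ConvexOn ℝ (Set.Ici 0) f) {y : ℝ} (h0 : 0 ≤ y)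
    (h1 : y ≤ 1) : f y ≤ (1 - y) * f 0 + y * f 1 := by
  have h := hf.2 (x := 0) (y := 1) (by simp) (by simp) (sub_nonneg.2 h1) h0 (by ring)
  simpa using h

/-- A convex function on the closed quadrant is continuous if it is monotone in the second
variable and continuous from below at the second axis. -/
lemma continuousOn_quadrant {F : ℝ × ℝ → ℝ} (hF : ConvexOn ℝ (Set.Ici 0 ×ˢ Set.Ici 0) F)
    (hmono : ∀ x, 0 ≤ x → ∀ y, 0 ≤ y → F (x, 0) ≤ F (x, y)) {ε : ℝ → ℝ}
    (hε : Tendsto ε (𝓝 0) (𝓝 0))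
    (hlow : ∀ x, 0 ≤ x → x ≤ 1 → ∀ y, 0 ≤ y → F (0, y) - ε x ≤ F (x, y)) :
    ContinuousOn F (Set.Ici 0 ×ˢ Set.Ici 0) := by
  -- At `y = 0` the slice lies between its value there, by monotonicity, and the chord over `[0,
  -- 1]`.
  have hslice : ∀ c, 0 ≤ c → ContinuousOn (fun y => F (c, y)) (Set.Ici 0) := by
    intro c hc y hy
    rcases (Set.mem_Ici.1 hy).eq_or_lt with rfl | hy
    · have hsl := convexOn_slice_right hF hc
      have hup : Tendsto (fun y : ℝ => (1 - y) * F (c, 0) + y * F (c, 1)) (𝓝[Set.Ici 0] 0)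
          (𝓝 (F (c, 0))) :=
        (Continuous.tendsto' (by fun_prop) _ _ (by simp)).mono_left nhdsWithin_le_nhds
      refine tendsto_of_tendsto_of_tendsto_of_le_of_le' tendsto_const_nhds hup ?_ ?_
      · filter_upwards [self_mem_nhdsWithin] with y hy using hmono c hc y hy
      · filter_upwards [self_mem_nhdsWithin,
          mem_nhdsWithin_of_mem_nhds (Iic_mem_nhds zero_lt_one)] with y hy hy1
        exact le_chord_of_convexOn hsl hy hy1
    · exact (continuousAt_of_convexOn (convexOn_slice_right hF hc) hy).continuousWithinAt
  rintro ⟨x, y⟩ ⟨hx, hy⟩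
  have hx : 0 ≤ x := hx
  have hy : 0 ≤ y := hy
  have hfst : Tendsto (fun p : ℝ × ℝ => p.1) (𝓝[Set.Ici 0 ×ˢ Set.Ici 0] (x, y)) (𝓝 x) :=
    continuous_fst.continuousWithinAt
  have hsnd : Tendsto (fun p : ℝ × ℝ => p.2) (𝓝[Set.Ici 0 ×ˢ Set.Ici 0] (x, y)) (𝓝 y) :=
    continuous_snd.continuousWithinAt
  have hmem : ∀ᶠ p : ℝ × ℝ in 𝓝[Set.Ici 0 ×ˢ Set.Ici 0] (x, y), 0 ≤ p.1 ∧ 0 ≤ p.2 :=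
    self_mem_nhdsWithin
  rcases hx.eq_or_lt with rfl | hxpos
  -- On the axis `x = 0` the upper bound is the chord in `x` between the slices at `0` and `1`; the
  -- lower bound is `hlow`.
  · have hsl : ∀ c, 0 ≤ c → Tendsto (fun p : ℝ × ℝ => F (c, p.2))
        (𝓝[Set.Ici 0 ×ˢ Set.Ici 0] (0, y)) (𝓝 (F (c, y))) := fun c hc =>
      Tendsto.comp (g := fun y => F (c, y)) (hslice c hc y hy)
        (tendsto_nhdsWithin_iff.2 ⟨hsnd, hmem.mono fun p hp => hp.2⟩)
    have hup : Tendsto (fun p : ℝ × ℝ => (1 - p.1) * F (0, p.2) + p.1 * F (1, p.2))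
        (𝓝[Set.Ici 0 ×ˢ Set.Ici 0] (0, y)) (𝓝 (F (0, y))) := by
      have := ((hfst.const_sub 1).mul (hsl 0 le_rfl)).add (hfst.mul (hsl 1 zero_le_one))
      simpa using this
    have hdown : Tendsto (fun p : ℝ × ℝ => F (0, p.2) - ε p.1)
        (𝓝[Set.Ici 0 ×ˢ Set.Ici 0] (0, y)) (𝓝 (F (0, y))) := by
      have := (hsl 0 le_rfl).sub (hε.comp hfst)
      simpa using this
    have hle1 : ∀ᶠ p : ℝ × ℝ in 𝓝[Set.Ici 0 ×ˢ Set.Ici 0] (0, y), p.1 ≤ 1 :=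
      hfst.eventually (Iic_mem_nhds zero_lt_one)
    refine tendsto_of_tendsto_of_tendsto_of_le_of_le' hdown hup ?_ ?_
    · filter_upwards [hmem, hle1] with p hp hp1 using hlow p.1 hp.1 hp1 p.2 hp.2
    · filter_upwards [hmem, hle1] with p hp hp1
      exact le_chord_of_convexOn (convexOn_slice_left hF hp.2) hp.1 hp1
  rcases hy.eq_or_lt with rfl | hypos
  -- On the axis `y = 0` with `x > 0` the chord runs in `y`, and monotonicity gives the lower bound.
  · have hsl : ∀ c, 0 ≤ c → Tendsto (fun p : ℝ × ℝ => F (p.1, c))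
        (𝓝[Set.Ici 0 ×ˢ Set.Ici 0] (x, 0)) (𝓝 (F (x, c))) := fun c hc =>
      Tendsto.comp (g := fun x => F (x, c)) (continuousAt_of_convexOn (convexOn_slice_left hF hc) hxpos) hfst
    have hup : Tendsto (fun p : ℝ × ℝ => (1 - p.2) * F (p.1, 0) + p.2 * F (p.1, 1))
        (𝓝[Set.Ici 0 ×ˢ Set.Ici 0] (x, 0)) (𝓝 (F (x, 0))) := by
      have := ((hsnd.const_sub 1).mul (hsl 0 le_rfl)).add (hsnd.mul (hsl 1 zero_le_one))
      simpa using this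
    have hle1 : ∀ᶠ p : ℝ × ℝ in 𝓝[Set.Ici 0 ×ˢ Set.Ici 0] (x, 0), p.2 ≤ 1 :=
      hsnd.eventually (Iic_mem_nhds zero_lt_one)
    refine tendsto_of_tendsto_of_tendsto_of_le_of_le' (hsl 0 le_rfl) hup ?_ ?_
    · filter_upwards [hmem] with p hp using hmono p.1 hp.1 p.2 hp.2
    · filter_upwards [hmem, hle1] with p hp hp1
      exact le_chord_of_convexOn (convexOn_slice_right hF hp.1) hp.2 hp1
  · refine (hF.continuousOn_interior.continuousAt ?_).continuousWithinAt
    rw [interior_prod_eq, interior_Ici]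
    exact prod_mem_nhds (Ioi_mem_nhds hxpos) (Ioi_mem_nhds hypos)

lemma convexOn_toReal_chi (hG : IsMarkFamily G) (hv : (Function.support v).Finite)
    (hq : ∀ k, 0 < q k) (hqsum : Summable q) :
    ConvexOn ℝ (Set.Ici 0 ×ˢ Set.Ici 0) fun p : ℝ × ℝ =>
      (chi G v q p.1.toNNReal p.2.toNNReal).toReal := by
  have hfin := chi_ne_top hG hv hq hqsum
  refine ⟨(convex_Ici 0).prod (convex_Ici 0), ?_⟩
  rintro ⟨x, y⟩ ⟨hx, hy⟩ ⟨x', y'⟩ ⟨hx', hy'⟩ a b ha hb hab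
  simp only [Set.mem_Ici] at hx hy hx' hy'
  lift x to ℝ≥0 using hx
  lift y to ℝ≥0 using hy
  lift x' to ℝ≥0 using hx'
  lift y' to ℝ≥0 using hy'
  lift a to ℝ≥0 using ha
  lift b to ℝ≥0 using hb
  have h := (convexOn_chi (G := G) (v := v) (q := q)).2 (Set.mem_univ (x, y))
    (Set.mem_univ (x', y')) (zero_le (a := a)) (zero_le (a := b)) (by exact_mod_cast hab)
  change chi G v q (a * x + b * x') (a * y + b * y')
    ≤ (a : ℝ≥0∞) * chi G v q x y + (b : ℝ≥0∞) * chi G v q x' y' at h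
  have h1 := hfin x y
  have h2 := hfin x' y'
  have h3 := ENNReal.toReal_mono (by finiteness) h
  rw [ENNReal.toReal_add (by finiteness) (by finiteness), ENNReal.toReal_mul,
    ENNReal.toReal_mul] at h3
  have e1 : ((a : ℝ) * x + b * x').toNNReal = a * x + b * x' := by
    rw [← Real.toNNReal_coe (r := a * x + b * x')]
    push_cast
    rfl
  have e2 : ((a : ℝ) * y + b * y').toNNReal = a * y + b * y' := by
    rw [← Real.toNNReal_coe (r := a * y + b * y')]
    push_cast
    rfl
  simpa [e1, e2] using h3

lemma continuous_chi (hG : IsMarkFamily G) (hv : (Function.support v).Finite)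
    (hq : ∀ k, 0 < q k) (hqsum : Summable q) :
    Continuous fun ρ : ℝ≥0 × ℝ≥0 => chi G v q ρ.1 ρ.2 := by
  have hfin := chi_ne_top hG hv hq hqsum
  have hlow : ∀ x : ℝ, 0 ≤ x → x ≤ 1 → ∀ y : ℝ, 0 ≤ y →
      (chi G v q (0 : ℝ).toNNReal y.toNNReal).toReal
        - (x * (∑' k, (q k : ℝ≥0∞)).toReal - x * Real.log x)
        ≤ (chi G v q x.toNNReal y.toNNReal).toReal := by
    intro x hx hx1 y _
    lift x to ℝ≥0 using hx
    rw [Real.toNNReal_coe, Real.toNNReal_zero]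
    rcases eq_or_ne x 0 with rfl | hx0
    · simp
    have hlog : 0 ≤ - Real.log x := by linarith [Real.log_nonpos x.coe_nonneg hx1]
    have h1 := hfin x y.toNNReal
    have h2 := tsum_coe_ne_top hqsum
    -- The choice `s = x` turns the error into `x ∑ q_k - x log x`, which tends to zero with `x`.
    have h := ENNReal.toReal_mono (by finiteness) (chi_zero_left_le hG hv hq x y.toNNReal
      (pos_iff_ne_zero.2 hx0) (by exact_mod_cast hx1))
    rw [ENNReal.toReal_add h1 (by finiteness), ENNReal.toReal_add (by finiteness) (by finiteness),
      ENNReal.toReal_mul, ENNReal.toReal_mul, ENNReal.toReal_ofReal hlog] at h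
    simp only [ENNReal.coe_toReal] at h
    linarith
  have hcont := continuousOn_quadrant (convexOn_toReal_chi hG hv hq hqsum)
    (fun x _ y hy => ENNReal.toReal_mono (hfin _ _)
      (monotone_chi _ (Real.toNNReal_mono hy)))
    (Continuous.tendsto' (by have := Real.continuous_mul_log; fun_prop) 0 0 (by simp)) hlow
  have h2 : Continuous fun ρ : ℝ≥0 × ℝ≥0 => (chi G v q ρ.1 ρ.2).toReal := by
    have := hcont.comp_continuous (f := fun ρ : ℝ≥0 × ℝ≥0 => ((ρ.1 : ℝ), (ρ.2 : ℝ)))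
      (by fun_prop) fun ρ => ⟨ρ.1.2, ρ.2.2⟩
    simpa [Function.comp_def] using this
  have h3 := ENNReal.continuous_ofReal.comp h2
  refine h3.congr fun ρ => ?_
  exact ENNReal.ofReal_toReal (hfin _ _)

end Continuity

end BoxBoseGas

theorem lemma2p2 {d : ℕ} (G : ℕ+ → Finset (BoxBoseGas.Site d)) (hG : BoxBoseGas.IsMarkFamily G)
    (v : BoxBoseGas.Site d → ℝ≥0) (hv : (Function.support v).Finite) (hsymm : ∀ x, v (-x) = v x)
    (q : ℕ+ → ℝ≥0) (hq : ∀ k, 0 < q k) (hqsum : Summable q) :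
    -- the limit defining the entropy density exists
    (∀ (m : ℕ+ → ℝ≥0), ∀ P ∈ BoxBoseGas.stationary d,
      Tendsto (BoxBoseGas.boxEntropy m P) atTop (𝓝 (BoxBoseGas.entropyDensity m P))) ∧
    -- joint convexity of `φ`
    ConvexOn ℝ≥0 {p : (ℕ+ → ℝ≥0) × (ℕ → ℝ≥0) | p.2 ∈ BoxBoseGas.probs}
      (fun p => BoxBoseGas.phi G v q p.1 p.2) ∧
    -- `χ` is finite, jointly convex and jointly continuous
    (∀ ρmi ρma : ℝ≥0, BoxBoseGas.chi G v q ρmi ρma ≠ ∞) ∧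
    ConvexOn ℝ≥0 Set.univ (fun ρ : ℝ≥0 × ℝ≥0 => BoxBoseGas.chi G v q ρ.1 ρ.2) ∧
    Continuous (fun ρ : ℝ≥0 × ℝ≥0 => BoxBoseGas.chi G v q ρ.1 ρ.2) ∧
    ConvexOn ℝ≥0 Set.univ (fun ρ : ℝ≥0 => BoxBoseGas.chi G v q ρ 0) ∧
    -- monotonicity of `φ` in `ψ`
    (∀ m : ℕ+ → ℝ≥0, ∀ ψ ∈ BoxBoseGas.probs, ∀ ψ' ∈ BoxBoseGas.probs,
      BoxBoseGas.StochLE ψ ψ' → BoxBoseGas.phi G v q m ψ ≤ BoxBoseGas.phi G v q m ψ') ∧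
    -- monotonicity of `χ` in `ρ_ma`
    (∀ ρmi : ℝ≥0, Monotone (fun ρma : ℝ≥0 => BoxBoseGas.chi G v q ρmi ρma)) ∧
    -- decomposition of the entropy density
    (∀ (m : ℕ+ → ℝ≥0), ∀ P ∈ BoxBoseGas.stationary d,
      (∀ k : ℕ+, ∫⁻ ω, (ω (0, k) : ℝ≥0∞) ∂P = m k) →
        BoxBoseGas.entropyDensity q P
          = BoxBoseGas.relEntropy m q + BoxBoseGas.entropyDensity m P) ∧
    (∀ m : ℕ+ → ℝ≥0,
      BoxBoseGas.entropyDensity q (BoxBoseGas.poissonProcess d m)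
        = BoxBoseGas.relEntropy m q) ∧
    -- value and slope at the origin
    BoxBoseGas.chi G v q 0 0 = BoxBoseGas.chi G 0 q 0 0 ∧
    BoxBoseGas.chi G v q 0 0 = ∑' k, (q k : ℝ≥0∞) ∧
    Tendsto (fun ρ : ℝ≥0 =>
        ((BoxBoseGas.chi G v q ρ 0).toReal - (BoxBoseGas.chi G v q 0 0).toReal) / (ρ : ℝ))
      (𝓝[>] 0) atBot ∧
    -- comparison with the non-interacting model
    (BoxBoseGas.vbar v ≤ 2 * v 0 → ∀ ρ : ℝ≥0,
      BoxBoseGas.chi G 0 q ρ 0 + (BoxBoseGas.vbar v : ℝ≥0∞) * (ρ : ℝ≥0∞) ^ 2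
        ≤ BoxBoseGas.chi G v q ρ 0) ∧
    (∀ ρ : ℝ≥0, BoxBoseGas.chi G v q ρ 0
        ≤ BoxBoseGas.chi G 0 q ρ 0
          + (BoxBoseGas.vbar v : ℝ≥0∞) * ((ρ : ℝ≥0∞) ^ 2 + (ρ : ℝ≥0∞))) := by
  exact ⟨fun m P hP => BoxBoseGas.tendsto_boxEntropy m hP,
    BoxBoseGas.convexOn_phi,
    BoxBoseGas.chi_ne_top hG hv hq hqsum,
    BoxBoseGas.convexOn_chi,
    BoxBoseGas.continuous_chi hG hv hq hqsum,
    BoxBoseGas.convexOn_chi_zero,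
    fun m ψ hψ ψ' hψ' h => BoxBoseGas.phi_mono_stochLE m hψ hψ' h,
    BoxBoseGas.monotone_chi,
    fun m P hP hm => BoxBoseGas.entropyDensity_eq_add hP hq hm,
    BoxBoseGas.entropyDensity_poissonProcess hq,
    (BoxBoseGas.chi_zero_zero hG hv hq).trans
      (BoxBoseGas.chi_zero_zero hG BoxBoseGas.finite_support_zero hq).symm,
    BoxBoseGas.chi_zero_zero hG hv hq,
    BoxBoseGas.tendsto_slope_chi hG hv hq hqsum,
    fun hv0 ρ => BoxBoseGas.chi_zero_add_le_chi hG hv hq hv0 ρ,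
    BoxBoseGas.chi_le_chi_zero_add hG hv hq⟩
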